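/- Let $k$ be a field and let $A$ be an associative unital $k$-algebra (not necessarily commutative or finite-dimensional). Write $A^e = A\otimes_k A^{\mathrm{op}}$ for the enveloping algebra, so that $k$-central $(A,A)$-bimodules are the same as left (or right) $A^e$-modules, via $(a\otimes b^{\mathrm{op}})\cdot m = amb = m\cdot(b\otimes a^{\mathrm{op}})$. A $k$-central $(A,A)$-bimodule $U$ is invertible if there is a $k$-central $(A,A)$-bimodule $V$ with $U\otimes_A V\cong A\cong V\otimes_A U$ as bimodules. The algebra $A$ is homologically smooth if, as a left $A^e$-module, it has a projective resolution of finite length whose terms are finitely generated. For an integer $d\ge 0$, $A$ is twisted Calabi-Yau of dimension $d$ if it is homologically smooth and there is an invertible $k$-central $(A,A)$-bimodule $U$ such that $\operatorname{Ext}^i_{A^e}(A,A^e)=0$ for all $i\neq d$ and $\operatorname{Ext}^d_{A^e}(A,A^e)\cong U$ as $(A,A)$-bimodules, where the bimodule structure on $\operatorname{Ext}^i_{A^e}(A,A^e)$ is induced by the right $A^e$-module structure of $A^e$. It is twisted Calabi-Yau if this holds for some $d\ge 0$, and Calabi-Yau of dimension $d$ if it holds for $d$ with $U\cong A$. Finally,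 $A$ is separable over $k$ if $A\otimes_k K$ is a semisimple ring for every field extension $K$ of $k$. **Theorem.** For every $k$-algebra $A$ the following are equivalent: (a) $A$ is twisted Calabi-Yau of dimension $0$; (b) $A$ is twisted Calabi-Yau and has finite dimension over $k$; (c) $A$ is Calabi-Yau of dimension $0$; (d) $A$ is a separable $k$-algebra. -/

import Mathlib

open scoped TensorProduct

noncomputable section

namespace TwistedCY

universe u v

open CategoryTheory MulOpposite

/-- The enveloping algebra `A ⊗ Aᵒᵖ` of a `k`-algebra `A`.  The `k`-central `(A, A)`-bimodules are
the left modules over it, via `(a ⊗ b) • m = a m b`. -/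
abbrev Env (k : Type u) (A : Type v) [Field k] [Ring A] [Algebra k A] : Type v :=
  A ⊗[k] Aᵐᵒᵖ

/-- `A` as a bimodule over itself: `(a ⊗ b) • x = a x b`. -/
instance instModuleEnvSelf (k : Type u) (A : Type v) [Field k] [Ring A] [Algebra k A] :
    Module (Env k A) A :=
  instModuleTensorProductMop k A

theorem env_tmul_smul (k : Type u) (A : Type v) [Field k] [Ring A] [Algebra k A]
    (a : A) (b : Aᵐᵒᵖ) (x : A) : ((a ⊗ₜ[k] b : Env k A)) • x = a * x * b.unop :=
  AlgHom.mulLeftRight_apply k A a b x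

instance instIsScalarTowerEnvSelf (k : Type u) (A : Type v) [Field k] [Ring A] [Algebra k A] :
    IsScalarTower k (Env k A) A where
  smul_assoc c r x := by
    change AlgHom.mulLeftRight k A (c • r) x = c • AlgHom.mulLeftRight k A r x
    simp

/-! ### Homological smoothness -/

/-- A left module over a ring is perfect if it has a projective resolution of finite length
with finitely generated terms. -/
def IsPerfectModule (R : Type v) [Ring R] (M : Type v) [AddCommGroup M] [Module R M] : Prop :=
  ∃ P : ProjectiveResolution (ModuleCat.of R M),
    (∀ i : ℕ, Module.Finite R (P.complex.X i)) ∧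
      ∃ n : ℕ, ∀ i : ℕ, n < i → Subsingleton (P.complex.X i)

/-- `A` is homologically smooth if it is perfect as a left module over its enveloping algebra. -/
def IsHomologicallySmooth (k : Type u) (A : Type v) [Field k] [Ring A] [Algebra k A] : Prop :=
  IsPerfectModule (Env k A) A

/-! ### The bimodules `Ext^i(A, A^e)` -/

/-- The anti-automorphism `a ⊗ b ↦ b ⊗ a` of the enveloping algebra, through which right modules
are identified with left modules: `(a ⊗ b) • m = m • (b ⊗ a)`. -/
def envSwap (k : Type u) (A : Type v) [Field k] [Ring A] [Algebra k A] :
    Env k A →ₗ[k] Env k A :=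
  (TensorProduct.map (opLinearEquiv k).symm.toLinearMap (opLinearEquiv k).toLinearMap) ∘ₗ
    (TensorProduct.comm k A Aᵐᵒᵖ).toLinearMap

@[simp]
theorem envSwap_tmul (k : Type u) (A : Type v) [Field k] [Ring A] [Algebra k A]
    (a : A) (b : Aᵐᵒᵖ) : envSwap k A (a ⊗ₜ[k] b) = b.unop ⊗ₜ[k] op a := rfl

theorem envSwap_one (k : Type u) (A : Type v) [Field k] [Ring A] [Algebra k A] :
    envSwap k A 1 = 1 := rfl

theorem envSwap_mul (k : Type u) (A : Type v) [Field k] [Ring A] [Algebra k A]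
    (x y : Env k A) : envSwap k A (x * y) = envSwap k A y * envSwap k A x := by
  induction x using TensorProduct.induction_on with
  | zero => simp
  | add x₁ x₂ h₁ h₂ => simp [add_mul, mul_add, h₁, h₂]
  | tmul a b =>
    induction y using TensorProduct.induction_on with
    | zero => simp
    | add y₁ y₂ h₁ h₂ => simp [add_mul, mul_add, h₁, h₂]
    | tmul c d => simp [Algebra.TensorProduct.tmul_mul_tmul]

/-- Right multiplication by `r`, an endomorphism of a ring as a left module over itself. -/
def rightMul (R : Type v) [Ring R] (r : R) : ModuleCat.of R R ⟶ ModuleCat.of R R :=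
  ModuleCat.ofHom (LinearMap.toSpanSingleton R R r)

theorem rightMul_apply (R : Type v) [Ring R] (r x : R) : (rightMul R r).hom x = x * r := rfl

theorem rightMul_one (R : Type v) [Ring R] : rightMul R 1 = 𝟙 _ := by
  ext; simp [rightMul]

theorem rightMul_mul (R : Type v) [Ring R] (r s : R) :
    rightMul R (r * s) = rightMul R r ≫ rightMul R s := by
  ext; simp [rightMul]

theorem rightMul_add (R : Type v) [Ring R] (r s : R) :
    rightMul R (r + s) = rightMul R r + rightMul R s := by
  ext; simp [rightMul]

theorem rightMul_zero (R : Type v) [Ring R] : rightMul R 0 = 0 := by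
  ext; simp [rightMul]

/-- `Ext^i(A, A^e)`, taken in the category of left modules over `A^e`. -/
def ExtEnv (k : Type u) (A : Type v) [Field k] [Ring A] [Algebra k A] (i : ℕ) : Type v :=
  Abelian.Ext.{v} (ModuleCat.of (Env k A) A) (ModuleCat.of (Env k A) (Env k A)) i

instance instAddCommGroupExtEnv (k : Type u) (A : Type v) [Field k] [Ring A] [Algebra k A]
    (i : ℕ) : AddCommGroup (ExtEnv k A i) :=
  inferInstanceAs (AddCommGroup
    (Abelian.Ext.{v} (ModuleCat.of (Env k A) A) (ModuleCat.of (Env k A) (Env k A)) i))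

/-- The right action of `A^e` on `Ext^i(A, A^e)` induced by right multiplication of `A^e` on
itself. -/
def ExtEnv.rightAct (k : Type u) (A : Type v) [Field k] [Ring A] [Algebra k A] {i : ℕ}
    (x : ExtEnv k A i) (r : Env k A) : ExtEnv k A i :=
  Abelian.Ext.comp x (Abelian.Ext.mk₀ (rightMul (Env k A) r)) (add_zero i)

/-- `Ext^i(A, A^e)` as an `(A, A)`-bimodule: its right `A^e`-module structure, read as a bimodule
structure through `(a ⊗ b) • m = m • (b ⊗ a)`. -/
instance instModuleExtEnv (k : Type u) (A : Type v) [Field k] [Ring A] [Algebra k A]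
    (i : ℕ) : Module (Env k A) (ExtEnv k A i) where
  smul r x := ExtEnv.rightAct k A x (envSwap k A r)
  one_smul x := by
    change ExtEnv.rightAct k A x (envSwap k A 1) = x
    rw [envSwap_one, ExtEnv.rightAct, rightMul_one]
    exact Abelian.Ext.comp_mk₀_id _
  mul_smul r s x := by
    change ExtEnv.rightAct k A x (envSwap k A (r * s)) =
      ExtEnv.rightAct k A (ExtEnv.rightAct k A x (envSwap k A s)) (envSwap k A r)
    rw [envSwap_mul, ExtEnv.rightAct, ExtEnv.rightAct, ExtEnv.rightAct, rightMul_mul,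
      ← Abelian.Ext.mk₀_comp_mk₀]
    exact (Abelian.Ext.comp_assoc_of_third_deg_zero _ _ _ _).symm
  smul_zero r := by
    change ExtEnv.rightAct k A 0 (envSwap k A r) = 0
    exact Abelian.Ext.zero_comp _ _ _ _ (add_zero i)
  smul_add r x y := by
    change ExtEnv.rightAct k A (x + y) (envSwap k A r) =
      ExtEnv.rightAct k A x (envSwap k A r) + ExtEnv.rightAct k A y (envSwap k A r)
    exact Abelian.Ext.add_comp _ _ _ (add_zero i)
  add_smul r s x := by
    change ExtEnv.rightAct k A x (envSwap k A (r + s)) =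
      ExtEnv.rightAct k A x (envSwap k A r) + ExtEnv.rightAct k A x (envSwap k A s)
    rw [map_add, ExtEnv.rightAct, rightMul_add, Abelian.Ext.mk₀_add]
    exact Abelian.Ext.comp_add _ _ _ _
  zero_smul x := by
    change ExtEnv.rightAct k A x (envSwap k A 0) = 0
    rw [map_zero, ExtEnv.rightAct, rightMul_zero, Abelian.Ext.mk₀_zero]
    exact Abelian.Ext.comp_zero _ _ _ _ _

/-! ### Invertible bimodules -/

/-- The tensor product `U ⊗ V` over `k` of two bimodules, equipped below with its outer bimodule
structure `(a ⊗ b) • (u ⊗ v) = (a u) ⊗ (v b)`. -/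
def OuterTensor (k : Type u) (U V : Type v) [Field k] [AddCommGroup U] [Module k U]
    [AddCommGroup V] [Module k V] : Type v :=
  U ⊗[k] V

section Tensor

variable (k : Type u) (A : Type v) [Field k] [Ring A] [Algebra k A]
variable (U V : Type v) [AddCommGroup U] [Module k U] [Module (Env k A) U]
  [IsScalarTower k (Env k A) U]
variable [AddCommGroup V] [Module k V] [Module (Env k A) V] [IsScalarTower k (Env k A) V]

instance instAddCommGroupOuterTensor : AddCommGroup (OuterTensor k U V) :=
  inferInstanceAs (AddCommGroup (U ⊗[k] V))

/-- The pure tensor `u ⊗ v`. -/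
def OuterTensor.mk {k : Type u} {U V : Type v} [Field k] [AddCommGroup U] [Module k U]
    [AddCommGroup V] [Module k V] (x : U) (y : V) : OuterTensor k U V :=
  x ⊗ₜ[k] y

/-- The algebra map from `A^e` to the endomorphisms of `U ⊗ V` that sends `a ⊗ b` to
`u ⊗ v ↦ (a u) ⊗ (v b)`. -/
def outerAct : Env k A →ₐ[k] Module.End k (U ⊗[k] V) :=
  (Module.endTensorEndAlgHom (R := k) (S := k) (A := k) (M := U) (N := V)).comp
    (Algebra.TensorProduct.map
      ((Algebra.lsmul k k U).comp (Algebra.TensorProduct.includeLeft : A →ₐ[k] Env k A))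
      ((Algebra.lsmul k k V).comp (Algebra.TensorProduct.includeRight : Aᵐᵒᵖ →ₐ[k] Env k A)))

theorem outerAct_tmul (a : A) (b : Aᵐᵒᵖ) (x : U) (y : V) :
    outerAct k A U V (a ⊗ₜ[k] b) (x ⊗ₜ[k] y) =
      ((a ⊗ₜ[k] 1 : Env k A) • x) ⊗ₜ[k] ((1 ⊗ₜ[k] b : Env k A) • y) := rfl

instance instModuleOuterTensor : Module (Env k A) (OuterTensor k U V) :=
  Module.compHom (U ⊗[k] V) (outerAct k A U V).toRingHom

theorem outerTensor_smul_mk (a : A) (b : Aᵐᵒᵖ) (x : U) (y : V) :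
    (a ⊗ₜ[k] b : Env k A) • (OuterTensor.mk x y : OuterTensor k U V) =
      OuterTensor.mk ((a ⊗ₜ[k] 1 : Env k A) • x) ((1 ⊗ₜ[k] b : Env k A) • y) := rfl

/-- The sub-bimodule of `U ⊗ V` spanned by the elements `(u a) ⊗ v - u ⊗ (a v)`; the set of these
elements is stable under the outer action of every `b ⊗ c`, so this is also their additive span. -/
def balancing : Submodule (Env k A) (OuterTensor k U V) :=
  Submodule.span (Env k A)
    {t | ∃ (x : U) (a : A) (y : V), t =
      OuterTensor.mk ((1 ⊗ₜ[k] op a : Env k A) • x) y -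
        OuterTensor.mk x ((a ⊗ₜ[k] 1 : Env k A) • y)}

/-- The tensor product of bimodules `U ⊗ V` over `A`, as an `(A, A)`-bimodule. -/
abbrev BimodTensor : Type v := OuterTensor k U V ⧸ balancing k A U V

/-- A `k`-central `(A, A)`-bimodule `U` is invertible if there is a `k`-central `(A, A)`-bimodule
`V` such that `U ⊗ V ≅ A ≅ V ⊗ U` (tensor products over `A`) as bimodules. -/
def IsInvertibleBimodule : Prop :=
  ∃ (V : Type v) (_ : AddCommGroup V) (_ : Module k V) (_ : Module (Env k A) V)
    (_ : IsScalarTower k (Env k A) V),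
    Nonempty (BimodTensor k A U V ≃ₗ[Env k A] A) ∧
      Nonempty (BimodTensor k A V U ≃ₗ[Env k A] A)

end Tensor

/-! ### Calabi-Yau conditions and separability -/

/-- `A` is twisted Calabi-Yau of dimension `d` with Nakayama bimodule `U`. -/
def IsTwistedCalabiYauWith (k : Type u) (A : Type v) [Field k] [Ring A] [Algebra k A] (d : ℕ)
    (U : Type v) [AddCommGroup U] [Module k U] [Module (Env k A) U]
    [IsScalarTower k (Env k A) U] : Prop :=
  IsHomologicallySmooth k A ∧ IsInvertibleBimodule k A U ∧
    (∀ i : ℕ, i ≠ d → Subsingleton (ExtEnv k A i)) ∧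
    Nonempty (ExtEnv k A d ≃ₗ[Env k A] U)

/-- `A` is twisted Calabi-Yau of dimension `d`. -/
def IsTwistedCalabiYauOfDim (k : Type u) (A : Type v) [Field k] [Ring A] [Algebra k A]
    (d : ℕ) : Prop :=
  ∃ (U : Type v) (_ : AddCommGroup U) (_ : Module k U) (_ : Module (Env k A) U)
    (_ : IsScalarTower k (Env k A) U), IsTwistedCalabiYauWith k A d U

/-- `A` is twisted Calabi-Yau (of some dimension). -/
def IsTwistedCalabiYau (k : Type u) (A : Type v) [Field k] [Ring A] [Algebra k A] : Prop :=
  ∃ d : ℕ, IsTwistedCalabiYauOfDim k A d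

/-- `A` is Calabi-Yau of dimension `d`: twisted Calabi-Yau with Nakayama bimodule `A`. -/
def IsCalabiYauOfDim (k : Type u) (A : Type v) [Field k] [Ring A] [Algebra k A]
    (d : ℕ) : Prop :=
  IsTwistedCalabiYauWith k A d A

/-- A `k`-algebra `A` is separable if `A ⊗ K` is semisimple for every field extension `K` of `k`.
The universe of `K` is large enough to hold both `k` and `A`. -/
def IsSeparableAlgebra (k : Type u) (A : Type v) [Field k] [Ring A] [Algebra k A] : Prop :=
  ∀ (K : Type max u v) [Field K] [Algebra k K], IsSemisimpleRing (A ⊗[k] K)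

end TwistedCY

end

noncomputable section

namespace TwistedCY

universe u v

open CategoryTheory MulOpposite

/-! ### Finiteness of separable algebras -/

/-! Everything passes through one condition: `A` is projective over `A^e`, or equivalently
(`projective_env_iff`) there is a separability idempotent, an element `z` of `A^e` with `a z = z a`
whose action sends `1` to `1`.

Projectivity gives (d) and finite dimension. Contracting the second factor of `z` with functionals
yields a finite-dimensional left ideal on which `A` acts faithfully. Averaging `K`-linear
projections with `z`, as in Maschke's theorem, makes every `K ⊗ A` semisimple.

The Calabi-Yau conditions give projectivity. A perfect module with `Ext^i(-, R) = 0` for all `i > 0`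
is projective, which settles dimension 0. Suppose instead that `A` is nonzero, finite-dimensional
and twisted Calabi-Yau of dimension `d > 0`. Then `Ext^d(A, -)` is right exact, so `Ext^d(A, A ⊗ N)`
behaves like `N ⊗_A U` for a finitely generated right module `N`. An invertible `U` is projective on
the left, so this functor preserves injections. Dimension shifting down from `d`, using `Ext^i(A,
A^e) = 0` for `i < d`, gives `Hom(A, A ⊗ N) = 0` for finite-dimensional `N`. For `N` the dual of
`A`, however, `A ⊗ N` is `End_k(A)`, and left multiplication is a nonzero bimodule map into it.

Separability gives (c). Finite dimension comes from a cardinality argument over a huge algebraically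
closed field. A form `t(x) = tr(y ↦ x y a)` is then symmetric and, for suitable `a`, nondegenerate;
the factor `a` is needed because the plain trace form of a matrix algebra can vanish in positive
characteristic. Through `t`, `A^e` becomes `End_k(A)` and the elements `z` with `b z = z b` become
right multiplications. Hence `Hom(A, A^e)` is `A` as a bimodule, and right multiplication by the
chosen `a` corresponds to a separability idempotent. -/

open Polynomial in
/-- Over a division algebra, the inverses of the translates of a transcendental element by scalars
are linearly independent. -/
theorem linearIndependent_inv_sub_of_transcendental {F D : Type*} [Field F] [DivisionRing D]
    [Algebra F D] {x : D} (H : Transcendental F x) :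
    LinearIndependent F fun a : F ↦ (x - algebraMap F D a)⁻¹ := by
  classical
  rw [transcendental_iff] at H
  refine linearIndependent_iff'.2 fun s m hm i hi ↦ ?_
  let q (j : F) : F[X] := (s.erase j).prod fun l ↦ .X - .C l
  have hnz (a : F) : x - algebraMap F D a ≠ 0 := by
    intro h
    have h0 : (X - C a : F[X]) = 0 := H _ (by rw [map_sub, aeval_X, aeval_C, h])
    exact X_sub_C_ne_zero a h0
  let b : F[X] := s.prod fun j ↦ .X - .C j
  have h1 : ∀ i ∈ s, aeval x b * (x - algebraMap F D i)⁻¹ = aeval x (q i) := fun i hi ↦ by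
    have : b = q i * (X - C i) := (s.prod_erase_mul _ hi).symm
    rw [this, map_mul]
    simp [mul_inv_cancel_right₀ (hnz i)]
  -- This is the relation after clearing denominators. It vanishes at the transcendental `x`, so it
  -- is the zero polynomial; evaluation at `i` then isolates `m i`.
  let p : F[X] := s.sum fun i ↦ .C (m i) * q i
  have hp : aeval x p = 0 := by
    have h2 : aeval x b * ∑ i ∈ s, m i • (x - algebraMap F D i)⁻¹ = 0 := by rw [hm, mul_zero]
    rw [Finset.mul_sum] at h2
    rw [← h2, map_sum]
    refine Finset.sum_congr rfl fun j hj ↦ ?_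
    rw [mul_smul_comm, h1 j hj, map_mul, aeval_C, Algebra.smul_def]
  have hp1 : p = 0 := H p hp
  have hp0 : eval i p = 0 := by rw [hp1, eval_zero]
  simp only [p] at hp0
  rw [eval_finsetSum, ← s.sum_erase_add _ hi, Finset.sum_eq_zero, zero_add] at hp0
  · simp only [eval_mul, eval_C, q, eval_prod, eval_sub, eval_X] at hp0
    exact eq_zero_of_ne_zero_of_mul_right_eq_zero (Finset.prod_ne_zero_iff.2 fun j hj ↦
      sub_ne_zero.2 (Finset.ne_of_mem_erase hj).symm) hp0
  · intro j hj
    have := Finset.mem_erase_of_ne_of_mem (Finset.ne_of_mem_erase hj).symm hi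
    rw [eval_mul, eval_prod, ← (s.erase j).prod_erase_mul _ this]
    simp

/-- A division algebra over an algebraically closed field whose dimension is smaller than the
cardinality of the field is trivial. -/
theorem finite_of_divisionRing_of_rank_lt {F D : Type v} [Field F] [IsAlgClosed F]
    [DivisionRing D] [Algebra F D] (h : Module.rank F D < Cardinal.mk F) : Module.Finite F D := by
  have : Algebra.IsIntegral F D := by
    refine ⟨fun x ↦ ?_⟩
    by_contra hx
    have ht : Transcendental F x := fun ha ↦ hx ha.isIntegral
    exact h.not_ge (linearIndependent_inv_sub_of_transcendental ht).cardinal_le_rank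
  have hb : Function.Bijective (algebraMap F D) := IsAlgClosed.algebraMap_bijective_of_isIntegral
  exact Module.Finite.of_surjective (Algebra.linearMap F D) hb.2

/-- A semisimple algebra over an algebraically closed field whose dimension is smaller than the
cardinality of the field is finite-dimensional. -/
theorem finite_of_isSemisimpleRing_of_rank_lt {F B : Type v} [Field F] [IsAlgClosed F]
    [Ring B] [Algebra F B] [IsSemisimpleRing B] (h : Module.rank F B < Cardinal.mk F) :
    Module.Finite F B := by
  obtain ⟨n, D, d, _, _, hd, ⟨e⟩⟩ := IsSemisimpleRing.exists_algEquiv_pi_matrix_divisionRing F B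
  have (i : Fin n) : Module.Finite F (D i) := by
    refine finite_of_divisionRing_of_rank_lt (lt_of_le_of_lt ?_ h)
    let l := Matrix.entryLinearMap F (D i) 0 0 ∘ₗ
      (.proj (φ := fun i ↦ Matrix (Fin (d i)) (Fin (d i)) (D i)) i) ∘ₗ e.toLinearMap
    refine LinearMap.rank_le_of_surjective l fun x ↦ ?_
    obtain ⟨y, hy⟩ := e.surjective (fun j _ _ ↦ Function.update (fun _ ↦ 0) i x j)
    exact ⟨y, by simp [l, hy]; rfl⟩
  exact Module.Finite.equiv e.symm.toLinearEquiv

/-- Every field has algebraically closed extensions of arbitrarily large cardinality. -/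
theorem exists_isAlgClosed_extension (k : Type u) [Field k] (A : Type v) :
    ∃ (K : Type max u v) (_ : Field K) (_ : Algebra k K), IsAlgClosed K ∧
      Cardinal.lift.{u} (Cardinal.mk A) < Cardinal.mk K := by
  -- One variable for each subset of `A`: Cantor's theorem makes the field larger than `A`.
  let S : Type max u v := Set (ULift.{u} A)
  let F := FractionRing (MvPolynomial S k)
  refine ⟨AlgebraicClosure F, inferInstance, inferInstance, inferInstance, ?_⟩
  have h1 : Cardinal.mk (ULift.{u} A) < Cardinal.mk S := by
    rw [Cardinal.mk_set]; exact Cardinal.cantor _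
  have h2 : Cardinal.mk S ≤ Cardinal.mk (AlgebraicClosure F) := by
    refine Cardinal.mk_le_of_injective (f := fun s : S ↦ algebraMap F (AlgebraicClosure F)
      (algebraMap (MvPolynomial S k) F (MvPolynomial.X s))) ?_
    exact (algebraMap F (AlgebraicClosure F)).injective.comp
      ((IsFractionRing.injective (MvPolynomial S k) F).comp (MvPolynomial.X_injective))
  rw [← Cardinal.mk_uLift]
  exact h1.trans_le h2

section

variable {k : Type u} {A : Type v} [Field k] [Ring A] [Algebra k A]

theorem IsSeparableAlgebra.isSemisimpleRing_baseChange (h : IsSeparableAlgebra k A)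
    (K : Type max u v) [Field K] [Algebra k K] : IsSemisimpleRing (K ⊗[k] A) :=
  have := h K
  (Algebra.TensorProduct.comm k A K).toRingEquiv.isSemisimpleRing

theorem IsSeparableAlgebra.isSemisimpleRing (h : IsSeparableAlgebra k A) : IsSemisimpleRing A := by
  -- The trivial extension, lifted to the universe in which `K` ranges.
  have := h (ULift.{v} k)
  exact (((Algebra.TensorProduct.congr AlgEquiv.refl ULift.algEquiv).trans
    (Algebra.TensorProduct.rid k k A) : A ⊗[k] ULift.{v} k ≃ₐ[k] A)).toRingEquiv.isSemisimpleRing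

/-- Over an algebraically closed `K` with more elements than `A`, the dimension of `K ⊗ A` is below
the cardinality of `K`, so semisimplicity forces it to be finite. Base change preserves dimension.
-/
theorem IsSeparableAlgebra.finite (h : IsSeparableAlgebra k A) : Module.Finite k A := by
  obtain ⟨K, _, _, _, hK⟩ := exists_isAlgClosed_extension k A
  have := h.isSemisimpleRing_baseChange K
  have hr : Module.rank K (K ⊗[k] A) = Cardinal.lift.{u} (Module.rank k A) := by
    rw [Module.rank_baseChange]
    exact congrFun Cardinal.lift_umax.{v, u} _
  have hfin : Module.Finite K (K ⊗[k] A) := by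
    refine finite_of_isSemisimpleRing_of_rank_lt (lt_of_le_of_lt ?_ hK)
    rw [hr]
    exact Cardinal.lift_le.2 (rank_le_card k A)
  rw [← Module.rank_lt_aleph0_iff] at hfin ⊢
  rwa [hr, Cardinal.lift_lt_aleph0] at hfin

end

/-! ### Symmetrizing forms on separable algebras -/

section Trace

variable (k : Type*) {A : Type*} [Field k] [Ring A] [Algebra k A]

/-- The functional sending `x` to the trace of `y ↦ x * y * a`. -/
def twistedTrace (a : A) : A →ₗ[k] k :=
  LinearMap.trace k A ∘ₗ (LinearMap.mul k A).compr₂ (LinearMap.mulRight k a)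

theorem twistedTrace_apply (a x : A) :
    twistedTrace k a x = LinearMap.trace k A (LinearMap.mulLeftRight k (x, a)) := rfl

/-- Left multiplication by `x` can be split off on either side of `b ↦ y b a`, and the trace is
cyclic. -/
theorem twistedTrace_mul_comm (a x y : A) :
    twistedTrace k a (x * y) = twistedTrace k a (y * x) := by
  have h1 : LinearMap.mulLeftRight k (x * y, a) =
      LinearMap.mulLeft k x * LinearMap.mulLeftRight k (y, a) := by
    ext; simp [mul_assoc]
  have h2 : LinearMap.mulLeftRight k (y * x, a) =
      LinearMap.mulLeftRight k (y, a) * LinearMap.mulLeft k x := by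
    ext; simp [mul_assoc]
  rw [twistedTrace_apply, twistedTrace_apply, h1, h2, LinearMap.trace_mul_comm]

theorem twistedTrace_add_left (a b : A) :
    twistedTrace k (a + b) = twistedTrace k a + twistedTrace k b := by
  ext x
  rw [LinearMap.add_apply, twistedTrace_apply, twistedTrace_apply, twistedTrace_apply, ← map_add]
  congr 1
  ext; simp [mul_add]

theorem twistedTrace_zero_left : twistedTrace k (0 : A) = 0 := by
  ext x
  rw [twistedTrace_apply, LinearMap.zero_apply, ← map_zero (LinearMap.trace k A)]
  congr 1
  ext; simp

theorem twistedTrace_baseChange [Module.Finite k A] (K : Type*) [Field K] [Algebra k K]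
    (c d : K) (a x : A) : twistedTrace K (c ⊗ₜ[k] a) (d ⊗ₜ[k] x) =
      d * c * algebraMap k K (twistedTrace k a x) := by
  have h : LinearMap.mulLeftRight K (d ⊗ₜ[k] x, c ⊗ₜ[k] a) =
      (d * c) • (LinearMap.mulLeftRight k (x, a)).baseChange K := by
    ext y
    simp [TensorProduct.smul_tmul']
  rw [twistedTrace_apply, h, map_smul, LinearMap.trace_baseChange, twistedTrace_apply, smul_eq_mul]

theorem twistedTrace_algEquiv {B : Type*} [Ring B] [Algebra k B] (e : A ≃ₐ[k] B) (a x : A) :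
    twistedTrace k (e a) (e x) = twistedTrace k a x := by
  have h := e.linearEquivConj_mulLeftRight (x, a)
  rw [twistedTrace_apply, twistedTrace_apply, ← LinearMap.trace_conj' _ e.toLinearEquiv, h]
  rfl

theorem twistedTrace_pi_single {ι : Type*} [Fintype ι] [DecidableEq ι] (B : ι → Type*)
    [∀ i, Ring (B i)] [∀ i, Algebra k (B i)] [∀ i, Module.Finite k (B i)] (a : ∀ i, B i) (i : ι)
    (x : B i) : twistedTrace k a (Pi.single i x) = twistedTrace k (a i) x := by
  have h1 : LinearMap.mulLeftRight k (Pi.single i x, a) = LinearMap.single k B i ∘ₗ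
      (LinearMap.mulLeftRight k (x, a i) ∘ₗ LinearMap.proj i) := by
    refine LinearMap.ext fun y ↦ funext fun j ↦ ?_
    by_cases hj : j = i
    · subst hj; simp
    · simp [hj]
  rw [twistedTrace_apply, h1, LinearMap.trace_comp_comm', LinearMap.comp_assoc,
    LinearMap.proj_comp_single_same, LinearMap.comp_id, twistedTrace_apply]

/-- For a matrix unit `E` in one block, `y ↦ E y E` is the rank-one map `y ↦ y₀₀ E`, of trace 1 in
every characteristic. -/
theorem exists_twistedTrace_ne_zero_of_isAlgClosed [IsAlgClosed k] [Module.Finite k A]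
    [IsSemisimpleRing A] [Nontrivial A] : ∃ a x : A, twistedTrace k a x ≠ 0 := by
  obtain ⟨n, d, hd, ⟨e⟩⟩ := IsSemisimpleRing.exists_algEquiv_pi_matrix_of_isAlgClosed k A
  have : Nonempty (Fin n) := by
    by_contra hn
    rw [not_nonempty_iff] at hn
    exact not_subsingleton A e.toEquiv.subsingleton
  obtain ⟨i⟩ := this
  let E : Π i, Matrix (Fin (d i)) (Fin (d i)) k := Pi.single i (Matrix.single 0 0 1)
  let f : A →ₗ[k] k := Matrix.entryLinearMap k k 0 0 ∘ₗ
      (.proj (φ := fun i ↦ Matrix (Fin (d i)) (Fin (d i)) k) i) ∘ₗ e.toLinearMap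
  have hf (y : A) : f y = e y i 0 0 := rfl
  refine ⟨e.symm E, e.symm E, ?_⟩
  have h : LinearMap.mulLeftRight k (e.symm E, e.symm E) = f.smulRight (e.symm E) := by
    refine LinearMap.ext fun y ↦ e.injective (funext fun j ↦ ?_)
    simp only [LinearMap.mulLeftRight_apply, map_mul, AlgEquiv.apply_symm_apply, Pi.mul_apply,
      LinearMap.smulRight_apply, map_smul, Pi.smul_apply, hf, E]
    by_cases hj : j = i
    · subst hj
      simp [Matrix.single_mul_mul_single]
    · simp [hj]
  rw [twistedTrace_apply, h, LinearMap.trace_smulRight, hf]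
  simp [E]

/-- The form is bilinear in `a` and `x` and compatible with base change, so if it vanished over `k`
it would vanish over `K`. -/
theorem exists_twistedTrace_ne_zero [Module.Finite k A] [Nontrivial A] (K : Type*) [Field K]
    [Algebra k K] [IsAlgClosed K] [IsSemisimpleRing (K ⊗[k] A)] :
    ∃ a x : A, twistedTrace k a x ≠ 0 := by
  by_contra! h
  obtain ⟨b, y, hb⟩ := exists_twistedTrace_ne_zero_of_isAlgClosed K (A := K ⊗[k] A)
  suffices hb0 : twistedTrace K b = 0 from hb (by rw [hb0, LinearMap.zero_apply])
  clear hb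
  induction b using TensorProduct.induction_on with
  | zero => rw [twistedTrace_zero_left]
  | add b c hb hc => rw [twistedTrace_add_left, hb, hc, add_zero]
  | tmul c a =>
    refine LinearMap.ext fun y ↦ ?_
    rw [LinearMap.zero_apply]
    induction y using TensorProduct.induction_on with
    | zero => rw [map_zero]
    | add x y hx hy => rw [map_add, hx, hy, add_zero]
    | tmul d x => rw [twistedTrace_baseChange, h, map_zero, mul_zero]

/-- A nonzero symmetric functional on a simple ring is nondegenerate. -/
theorem eq_zero_of_forall_mul_eq_zero [IsSimpleRing A] {t : A →ₗ[k] k}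
    (ht : ∀ x y, t (x * y) = t (y * x)) (h0 : t ≠ 0) (x : A) (hx : ∀ y, t (x * y) = 0) :
    x = 0 := by
  -- Symmetry of `t` makes its radical a two-sided ideal.
  let I : TwoSidedIdeal A := .mk' {x | ∀ y, t (x * y) = 0} (by simp)
    (fun {x y} hx hy z ↦ by rw [add_mul, map_add, hx, hy, add_zero])
    (fun {x} hx z ↦ by rw [neg_mul, map_neg, hx, neg_zero])
    (fun {x y} hy z ↦ by rw [mul_assoc, ht, mul_assoc, hy])
    (fun {x y} hx z ↦ by rw [mul_assoc, hx])
  have hI (x : A) : x ∈ I ↔ ∀ y, t (x * y) = 0 := TwoSidedIdeal.mem_mk' ..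
  rcases eq_bot_or_eq_top I with h | h
  · rw [← TwoSidedIdeal.mem_bot A, ← h, hI]
    exact hx
  · refine absurd (LinearMap.ext fun y ↦ ?_) h0
    have h1 : (1 : A) ∈ I := h ▸ TwoSidedIdeal.mem_top A
    simpa using (hI 1).1 h1 y

end Trace

/-- A separable algebra has a nondegenerate form `x ↦ tr (y ↦ x * y * a)`. -/
theorem IsSeparableAlgebra.exists_twistedTrace_nondegenerate {k : Type u} {A : Type v} [Field k]
    [Ring A] [Algebra k A] (h : IsSeparableAlgebra k A) :
    ∃ a : A, ∀ x, (∀ y, twistedTrace k a (x * y) = 0) → x = 0 := by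
  have := h.finite
  have := h.isSemisimpleRing
  obtain ⟨n, D, d, _, _, _, hd, ⟨e⟩⟩ :=
    IsSemisimpleRing.exists_algEquiv_pi_matrix_divisionRing_finite k A
  let B (i : Fin n) : Type v := Matrix (Fin (d i)) (Fin (d i)) (D i)
  obtain ⟨K, _, _, _, -⟩ := exists_isAlgClosed_extension k A
  have := h.isSemisimpleRing_baseChange K
  -- Each simple block is a quotient of `A`, so its base change stays semisimple. One `a i` is
  -- chosen per block and simplicity upgrades nonvanishing to nondegeneracy.
  have hB (i : Fin n) : ∃ a x : B i, twistedTrace k a x ≠ 0 := by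
    have : IsSemisimpleRing (K ⊗[k] B i) := by
      let p : A →ₐ[k] B i := (Pi.evalAlgHom k B i).comp e.toAlgHom
      have hp : Function.Surjective p := (Function.surjective_eval i).comp e.surjective
      exact (Algebra.TensorProduct.map (AlgHom.id k K) p).toRingHom.isSemisimpleRing_of_surjective
        (TensorProduct.map_surjective Function.surjective_id hp)
    exact exists_twistedTrace_ne_zero k K
  choose a x hax using hB
  refine ⟨e.symm a, fun z hz ↦ e.injective ?_⟩
  rw [map_zero]
  refine funext fun i ↦ eq_zero_of_forall_mul_eq_zero k (twistedTrace_mul_comm k (a i))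
    (fun h0 ↦ hax i (by rw [h0, LinearMap.zero_apply])) _ fun w ↦ ?_
  -- Pairing with an element supported in block `i` only sees the form of that block.
  have := hz (e.symm (Pi.single i w))
  rw [← twistedTrace_algEquiv k e, map_mul, e.apply_symm_apply, e.apply_symm_apply] at this
  rw [← twistedTrace_pi_single k B a i, ← this]
  congr 1
  refine funext fun j ↦ ?_
  by_cases hj : j = i
  · subst hj; simp
  · simp [hj]

/-! ### Central elements of the enveloping algebra and separability idempotents -/

section Central

variable {k : Type u} {A : Type v} [Field k] [Ring A] [Algebra k A]

theorem env_zero_smul (x : A) : (0 : Env k A) • x = 0 := zero_smul (Env k A) x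

theorem env_tmul_one_smul_one (x : A) : (x ⊗ₜ[k] 1 : Env k A) • (1 : A) = x := by
  rw [env_tmul_smul]; simp

theorem env_one_tmul_smul_one (x : A) : (1 ⊗ₜ[k] op x : Env k A) • (1 : A) = x := by
  rw [env_tmul_smul]; simp

/-- The bimodule map `A → A^e` that sends `1` to a given element `z` with `a z = z a`. -/
def homOfCentral (z : Env k A) (hz : ∀ a : A, (a ⊗ₜ[k] 1) * z = (1 ⊗ₜ[k] op a) * z) :
    A →ₗ[Env k A] Env k A where
  toFun x := (x ⊗ₜ[k] 1) * z
  map_add' x y := by rw [TensorProduct.add_tmul, add_mul]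
  map_smul' r x := by
    induction r using TensorProduct.induction_on with
    | zero =>
      rw [env_zero_smul, TensorProduct.zero_tmul, zero_mul]
      exact (zero_smul (Env k A) ((x ⊗ₜ[k] 1 : Env k A) * z)).symm
    | add r s hr hs =>
      rw [add_smul, TensorProduct.add_tmul, add_mul, hr, hs, RingHom.id_apply, RingHom.id_apply,
        RingHom.id_apply, add_smul]
    | tmul c d =>
      have h1 : ((c * x * d.unop) ⊗ₜ[k] 1 : Env k A) = (c * x) ⊗ₜ[k] 1 * d.unop ⊗ₜ[k] 1 := by
        rw [Algebra.TensorProduct.tmul_mul_tmul, mul_one]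
      rw [env_tmul_smul, h1, mul_assoc, hz, RingHom.id_apply, smul_eq_mul, ← mul_assoc,
        ← mul_assoc]
      simp

theorem homOfCentral_one (z : Env k A) (hz : ∀ a : A, (a ⊗ₜ[k] 1) * z = (1 ⊗ₜ[k] op a) * z) :
    homOfCentral z hz 1 = z := one_mul z

theorem hom_env_apply (g : A →ₗ[Env k A] Env k A) (x : A) : g x = (x ⊗ₜ[k] 1) * g 1 := by
  rw [← smul_eq_mul, ← map_smul, env_tmul_one_smul_one]

theorem hom_env_one_central (g : A →ₗ[Env k A] Env k A) (x : A) :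
    (x ⊗ₜ[k] 1) * g 1 = (1 ⊗ₜ[k] op x) * g 1 := by
  rw [← smul_eq_mul, ← smul_eq_mul, ← map_smul, ← map_smul, env_tmul_one_smul_one,
    env_one_tmul_smul_one]

/-- `A` is projective over `A^e` iff there is a separability idempotent. -/
theorem projective_env_iff : Module.Projective (Env k A) A ↔
    ∃ z : Env k A, (∀ a : A, (a ⊗ₜ[k] 1) * z = (1 ⊗ₜ[k] op a) * z) ∧ z • (1 : A) = 1 := by
  constructor
  · intro h
    obtain ⟨g, hg⟩ := Module.projective_lifting_property
      (LinearMap.toSpanSingleton (Env k A) A 1) LinearMap.id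
      (fun x ↦ ⟨x ⊗ₜ 1, env_tmul_one_smul_one x⟩)
    exact ⟨g 1, hom_env_one_central g, LinearMap.congr_fun hg 1⟩
  · rintro ⟨z, hz, h1⟩
    refine Module.Projective.of_split (homOfCentral z hz)
      (LinearMap.toSpanSingleton (Env k A) A 1) (LinearMap.ext fun x ↦ ?_)
    change ((x ⊗ₜ[k] 1 : Env k A) * z) • (1 : A) = x
    rw [mul_smul, h1, env_tmul_one_smul_one]

end Central

/-! ### Projectivity over the enveloping algebra forces finite dimension -/

section Finite

variable {k : Type u} {A : Type v} [Field k] [Ring A] [Algebra k A]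

/-- Contraction of the second factor of the enveloping algebra with a functional. -/
def contractRight : Env k A →ₗ[k] Module.Dual k Aᵐᵒᵖ →ₗ[k] A :=
  TensorProduct.lift (LinearMap.mk₂ k (fun x y ↦ (Module.Dual.eval k Aᵐᵒᵖ y).smulRight x)
    (fun _ _ _ ↦ by ext; exact smul_add _ _ _) (fun _ _ _ ↦ by ext; exact smul_comm _ _ _)
    (fun _ _ _ ↦ by ext; simp [add_smul]) (fun _ _ _ ↦ by ext; simp [mul_smul]))

theorem contractRight_tmul (x : A) (y : Aᵐᵒᵖ) (f : Module.Dual k Aᵐᵒᵖ) :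
    contractRight (x ⊗ₜ[k] y) f = f y • x := rfl

theorem contractRight_left_mul (a : A) (z : Env k A) (f : Module.Dual k Aᵐᵒᵖ) :
    contractRight ((a ⊗ₜ[k] 1) * z) f = a * contractRight z f := by
  induction z using TensorProduct.induction_on with
  | zero => simp
  | add x y hx hy => simp [mul_add, hx, hy]
  | tmul x y => simp [contractRight_tmul]

theorem contractRight_right_mul (a : A) (z : Env k A) (f : Module.Dual k Aᵐᵒᵖ) :
    contractRight ((1 ⊗ₜ[k] op a) * z) f =
      contractRight z (f ∘ₗ LinearMap.mulLeft k (op a)) := by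
  induction z using TensorProduct.induction_on with
  | zero => simp
  | add x y hx hy => simp [mul_add, hx, hy]
  | tmul x y => simp [contractRight_tmul]

theorem contractRight_injective : Function.Injective (contractRight (k := k) (A := A)) := by
  rw [injective_iff_map_eq_zero]
  intro z hz
  let b := Module.Free.chooseBasis k Aᵐᵒᵖ
  apply (TensorProduct.equivFinsuppOfBasisRight (M := A) b).injective
  rw [map_zero]
  ext i
  have h : ∀ z : Env k A, TensorProduct.equivFinsuppOfBasisRight (M := A) b z i =
      contractRight z (b.coord i) := by
    intro z
    induction z using TensorProduct.induction_on with
    | zero => simp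
    | add x y hx hy => simp [hx, hy]
    | tmul x y => simp [contractRight_tmul]
  rw [h, hz]; rfl

/-- A pure tensor contracts into a line, and `z` is a finite sum of pure tensors. -/
theorem finite_range_contractRight (z : Env k A) :
    Module.Finite k (LinearMap.range (contractRight z)) := by
  induction z using TensorProduct.induction_on with
  | zero => rw [map_zero, LinearMap.range_zero]; infer_instance
  | add x y hx hy =>
    have : LinearMap.range (contractRight (x + y)) ≤
        LinearMap.range (contractRight x) ⊔ LinearMap.range (contractRight y) := by
      rw [map_add]; exact LinearMap.range_add_le _ _
    exact Submodule.finiteDimensional_of_le this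
  | tmul x y =>
    have : LinearMap.range (contractRight (x ⊗ₜ[k] y)) ≤ k ∙ x := by
      rintro _ ⟨f, rfl⟩
      exact Submodule.smul_mem _ _ (Submodule.mem_span_singleton_self x)
    exact Submodule.finiteDimensional_of_le this

/-- An algebra that is projective over its enveloping algebra is finite-dimensional. -/
theorem finite_of_projective_env (h : Module.Projective (Env k A) A) : Module.Finite k A := by
  obtain ⟨z, hz, h1⟩ := projective_env_iff.1 h
  -- `W` is a left ideal since `a z = z a`. The action on it is faithful: if `a` kills `W` then `(a
  -- ⊗ 1) z = 0`, and applying this to `1` gives `a = 0`. So `A` embeds in `End_k(W)`.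
  let W := LinearMap.range (contractRight z)
  have : Module.Finite k W := finite_range_contractRight z
  have hW (a w : A) (hw : w ∈ W) : a * w ∈ W := by
    obtain ⟨f, rfl⟩ := hw
    rw [← contractRight_left_mul, hz, contractRight_right_mul]
    exact ⟨_, rfl⟩
  let ρ : A →ₗ[k] (W →ₗ[k] A) := (LinearMap.mul k A).compl₁₂ LinearMap.id W.subtype
  refine Module.Finite.of_injective
    (⟨⟨fun a ↦ (ρ a).codRestrict W fun w ↦ hW a w w.2, fun a b ↦ ?_⟩, fun c a ↦ ?_⟩ :
      A →ₗ[k] (W →ₗ[k] W)) ((injective_iff_map_eq_zero _).2 fun a ha ↦ ?_)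
  · ext; simp; rfl
  · ext; simp; rfl
  · have h0 : contractRight ((a ⊗ₜ[k] 1) * z) = 0 := by
      ext f
      rw [contractRight_left_mul]
      exact congrArg Subtype.val (LinearMap.congr_fun ha ⟨_, f, rfl⟩)
    have h2 : (a ⊗ₜ[k] 1) * z = 0 := contractRight_injective (by rw [h0, map_zero])
    rw [← env_tmul_one_smul_one (k := k) a, ← h1, ← mul_smul, h2, env_zero_smul]

end Finite

/-! ### Semisimplicity of base changes by averaging -/

section Semisimple

variable {k : Type u} {A : Type v} [Field k] [Ring A] [Algebra k A]

/-- For `p` an endomorphism of `K ⊗ A`, the bilinear map `(x, y) ↦ x p(y -)`, as a linear map on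
the enveloping algebra. -/
def averaging (K : Type*) [Field K] [Algebra k K] (p : K ⊗[k] A →ₗ[K] K ⊗[k] A)
    (s : K ⊗[k] A) : Env k A →ₗ[k] K ⊗[k] A :=
  TensorProduct.lift (LinearMap.mk₂ k (fun x y ↦ (1 ⊗ₜ x) * p ((1 ⊗ₜ y.unop) * s))
    (fun _ _ _ ↦ by rw [TensorProduct.tmul_add, add_mul])
    (fun _ _ _ ↦ by rw [TensorProduct.tmul_smul, smul_mul_assoc])
    (fun _ _ _ ↦ by rw [MulOpposite.unop_add, TensorProduct.tmul_add, add_mul, map_add, mul_add])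
    (fun c x y ↦ by
      rw [MulOpposite.unop_smul, TensorProduct.tmul_smul, smul_mul_assoc, ← algebraMap_smul K c, map_smul,
        mul_smul_comm, algebraMap_smul]))

variable (K : Type*) [Field K] [Algebra k K] (p : K ⊗[k] A →ₗ[K] K ⊗[k] A)

theorem averaging_tmul (s : K ⊗[k] A) (x : A) (y : Aᵐᵒᵖ) :
    averaging K p s (x ⊗ₜ[k] y) = (1 ⊗ₜ x) * p ((1 ⊗ₜ y.unop) * s) := rfl

theorem averaging_left_mul (s : K ⊗[k] A) (a : A) (z : Env k A) :
    averaging K p s ((a ⊗ₜ[k] 1) * z) = (1 ⊗ₜ a) * averaging K p s z := by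
  induction z using TensorProduct.induction_on with
  | zero => simp
  | add x y hx hy => rw [mul_add, map_add, hx, hy, map_add, mul_add]
  | tmul x y =>
    rw [Algebra.TensorProduct.tmul_mul_tmul, one_mul, averaging_tmul, averaging_tmul, ← mul_assoc,
      Algebra.TensorProduct.tmul_mul_tmul, one_mul]

theorem averaging_right_mul (s : K ⊗[k] A) (a : A) (z : Env k A) :
    averaging K p s ((1 ⊗ₜ[k] op a) * z) = averaging K p ((1 ⊗ₜ a) * s) z := by
  induction z using TensorProduct.induction_on with
  | zero => simp
  | add x y hx hy => rw [mul_add, map_add, hx, hy, map_add]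
  | tmul x y =>
    rw [Algebra.TensorProduct.tmul_mul_tmul, one_mul, averaging_tmul, averaging_tmul, ← mul_assoc,
      Algebra.TensorProduct.tmul_mul_tmul, one_mul]
    rfl

theorem averaging_add (s t : K ⊗[k] A) (z : Env k A) :
    averaging K p (s + t) z = averaging K p s z + averaging K p t z := by
  induction z using TensorProduct.induction_on with
  | zero => simp
  | add x y hx hy => rw [map_add, map_add, map_add, hx, hy]; abel
  | tmul x y => simp only [averaging_tmul, mul_add, map_add]

theorem averaging_smul (c : K) (s : K ⊗[k] A) (z : Env k A) :
    averaging K p (c • s) z = c • averaging K p s z := by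
  induction z using TensorProduct.induction_on with
  | zero => simp
  | add x y hx hy => rw [map_add, map_add, hx, hy, smul_add]
  | tmul x y => simp only [averaging_tmul, mul_smul_comm, map_smul]

theorem averaging_mem (N : Submodule (K ⊗[k] A) (K ⊗[k] A)) (hp : ∀ s, p s ∈ N)
    (s : K ⊗[k] A) (z : Env k A) : averaging K p s z ∈ N := by
  induction z using TensorProduct.induction_on with
  | zero => simp
  | add x y hx hy => rw [map_add]; exact N.add_mem hx hy
  | tmul x y => exact N.smul_mem _ (hp _)

theorem averaging_of_mem (N : Submodule (K ⊗[k] A) (K ⊗[k] A)) (hp : ∀ s ∈ N, p s = s)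
    (s : K ⊗[k] A) (hs : s ∈ N) (z : Env k A) :
    averaging K p s z = (1 ⊗ₜ (z • (1 : A))) * s := by
  induction z using TensorProduct.induction_on with
  | zero => rw [map_zero, env_zero_smul, TensorProduct.tmul_zero, zero_mul]
  | add x y hx hy => rw [map_add, hx, hy, add_smul, TensorProduct.tmul_add, add_mul]
  | tmul x y =>
    rw [averaging_tmul, hp ((1 ⊗ₜ y.unop) * s) (N.smul_mem _ hs), ← mul_assoc, env_tmul_smul, mul_one,
      Algebra.TensorProduct.tmul_mul_tmul, one_mul]

/-- Maschke's argument: with `z = ∑ x ⊗ y` and `q` a `K`-linear projection onto `N`, the map `s ↦ ∑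
x q(y s)` is `K ⊗ A`-linear because `a z = z a`, and restricts to the identity on `N` because `∑ x y
= 1`. -/
theorem isSemisimpleRing_of_projective_env (h : Module.Projective (Env k A) A) :
    IsSemisimpleRing (K ⊗[k] A) := by
  obtain ⟨z, hz, h1⟩ := projective_env_iff.1 h
  refine (isSemisimpleModule_iff _ _).2 ⟨fun N ↦ ?_⟩
  obtain ⟨p, hp⟩ := (N.restrictScalars K).exists_isCompl
  let q : K ⊗[k] A →ₗ[K] K ⊗[k] A := (N.restrictScalars K).subtype ∘ₗ
    Submodule.projectionOnto _ _ hp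
  have hq (s) : q s ∈ N := (Submodule.projectionOnto _ _ hp s).2
  have hq' (s) (hs : s ∈ N) : q s = s :=
    congrArg Subtype.val (Submodule.projectionOnto_apply_left hp ⟨s, hs⟩)
  let f : K ⊗[k] A →ₗ[K ⊗[k] A] N :=
    { toFun s := ⟨averaging K q s z, averaging_mem K q N hq s z⟩
      map_add' s t := Subtype.ext (averaging_add K q s t z)
      map_smul' r s := Subtype.ext <| by
        change averaging K q (r * s) z = r * averaging K q s z
        induction r using TensorProduct.induction_on with
        | zero => 
          rw [zero_mul, zero_mul]
          exact (congrArg (averaging K q · z) (zero_smul K 0).symm).trans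
            ((averaging_smul K q 0 0 z).trans (zero_smul K _))
        | add r t hr ht => rw [add_mul, averaging_add, hr, ht, add_mul]
        | tmul c a =>
          have : c ⊗ₜ[k] a = c • ((1 : K) ⊗ₜ[k] a) := by
            rw [TensorProduct.smul_tmul', smul_eq_mul, mul_one]
          rw [this, smul_mul_assoc, averaging_smul, ← averaging_right_mul, ← hz,
            averaging_left_mul, smul_mul_assoc] }
  refine ⟨_, LinearMap.isCompl_of_proj (f := f) fun n ↦ Subtype.ext ?_⟩
  change averaging K q n z = n
  rw [averaging_of_mem K q N hq' n n.2, h1]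
  exact one_mul _

theorem isSeparableAlgebra_of_projective_env (h : Module.Projective (Env k A) A) :
    IsSeparableAlgebra k A := fun K _ _ ↦
  have := isSemisimpleRing_of_projective_env K h
  (Algebra.TensorProduct.comm k K A).toRingEquiv.isSemisimpleRing

end Semisimple

/-! ### The enveloping algebra of a symmetric algebra -/

section Form

variable {k : Type u} {A : Type v} [Field k] [Ring A] [Algebra k A] (t : A →ₗ[k] k)

/-- The functional `b ↦ t (v * b)` attached to `v`. -/
def formDual : Aᵐᵒᵖ →ₗ[k] Module.Dual k A :=
  ((LinearMap.mul k A).compr₂ t) ∘ₗ (opLinearEquiv k).symm.toLinearMap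

theorem formDual_apply (v : Aᵐᵒᵖ) (b : A) : formDual t v b = t (v.unop * b) := rfl

/-- The map from `A^e` to the endomorphisms of `A` sending `u ⊗ v` to `b ↦ t (v * b) • u`. -/
def envToEnd : Env k A →ₗ[k] (A →ₗ[k] A) :=
  dualTensorHom k A A ∘ₗ (TensorProduct.comm k A (Module.Dual k A)).toLinearMap ∘ₗ
    TensorProduct.map LinearMap.id (formDual t)

theorem envToEnd_tmul (x : A) (y : Aᵐᵒᵖ) (b : A) :
    envToEnd t (x ⊗ₜ[k] y) b = t (y.unop * b) • x := rfl

theorem envToEnd_left_mul (a : A) (z : Env k A) (b : A) :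
    envToEnd t ((a ⊗ₜ[k] 1) * z) b = a * envToEnd t z b := by
  induction z using TensorProduct.induction_on with
  | zero => simp
  | add x y hx hy => simp [mul_add, hx, hy]
  | tmul x y => simp [envToEnd_tmul]

/-- With `envToEnd_left_mul`, this turns `b z = z b` into commutation with left multiplications,
which singles out the right multiplications. -/
theorem envToEnd_right_mul (a : A) (z : Env k A) (b : A) :
    envToEnd t ((1 ⊗ₜ[k] op a) * z) b = envToEnd t z (a * b) := by
  induction z using TensorProduct.induction_on with
  | zero => simp
  | add x y hx hy => simp [mul_add, hx, hy]
  | tmul x y => simp [envToEnd_tmul, mul_assoc]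

variable {t}

theorem envToEnd_mul_tmul (ht : ∀ x y, t (x * y) = t (y * x)) (c d : A) (z : Env k A) :
    envToEnd t (z * (c ⊗ₜ[k] op d)) 1 = envToEnd t z d * c := by
  induction z using TensorProduct.induction_on with
  | zero => simp
  | add x y hx hy => simp [add_mul, hx, hy]
  | tmul x y => simp [envToEnd_tmul, ht d]

/-- Nondegeneracy identifies `Aᵐᵒᵖ` with the dual of `A`, and `A ⊗ A*` is `End_k(A)` in finite
dimension. -/
theorem envToEnd_bijective [Module.Finite k A] (h : ∀ x, (∀ y, t (x * y) = 0) → x = 0) :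
    Function.Bijective (envToEnd t) := by
  have hinj : Function.Injective (formDual t) := (injective_iff_map_eq_zero _).2 fun v hv ↦
    unop_injective (h _ fun y ↦ LinearMap.congr_fun hv y)
  have : Module.Finite k Aᵐᵒᵖ := Module.Finite.equiv (opLinearEquiv k)
  have hr : Module.finrank k Aᵐᵒᵖ = Module.finrank k (Module.Dual k A) := by
    rw [Subspace.dual_finrank_eq, ← (opLinearEquiv k : A ≃ₗ[k] Aᵐᵒᵖ).finrank_eq]
  let e := LinearEquiv.ofInjectiveOfFinrankEq (formDual t) hinj hr
  have : envToEnd t = ((TensorProduct.congr (.refl k A) e).trans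
      ((TensorProduct.comm k A (Module.Dual k A)).trans (dualTensorHomEquiv k A A))).toLinearMap := by
    refine TensorProduct.ext' fun x y ↦ ?_
    ext b
    rfl
  rw [this]
  exact LinearEquiv.bijective _

/-- For `z = u ⊗ v` the operator on the right has rank at most one and trace `t(v x u)`, which is
`t(u v x)` by symmetry. -/
theorem apply_smul_one_mul [Module.Finite k A] (ht : ∀ x y, t (x * y) = t (y * x))
    (z : Env k A) (x : A) :
    t (z • (1 : A) * x) = LinearMap.trace k A (LinearMap.mulLeft k x ∘ₗ envToEnd t z) := by
  induction z using TensorProduct.induction_on with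
  | zero => rw [env_zero_smul]; simp
  | add y z hy hz => rw [add_smul, add_mul, map_add, hy, hz, map_add, LinearMap.comp_add, map_add]
  | tmul u v =>
    have : LinearMap.mulLeft k x ∘ₗ envToEnd t (u ⊗ₜ[k] v) = (formDual t v).smulRight (x * u) := by
      ext b
      simp [envToEnd_tmul, formDual_apply]
    rw [this, LinearMap.trace_smulRight, formDual_apply, env_tmul_smul, mul_one, ← mul_assoc, ht _ u,
      mul_assoc]

/-- The elements `z` of `A^e` with `a z = z a` for a symmetric algebra `A`. -/
theorem exists_central_envToEnd [Module.Finite k A] (h : ∀ x, (∀ y, t (x * y) = 0) → x = 0)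
    (a : A) : ∃ z : Env k A, envToEnd t z = LinearMap.mulRight k a ∧
      ∀ b : A, (b ⊗ₜ[k] 1) * z = (1 ⊗ₜ[k] op b) * z := by
  obtain ⟨z, hz⟩ := (envToEnd_bijective h).2 (LinearMap.mulRight k a)
  refine ⟨z, hz, fun b ↦ (envToEnd_bijective h).1 (LinearMap.ext fun c ↦ ?_)⟩
  rw [envToEnd_left_mul, envToEnd_right_mul, hz]
  simp [mul_assoc]

/-- Take `z` corresponding to right multiplication by `a`. The trace formula gives `t((z • 1) x) =
tr(y ↦ x y a) = t(x)` for all `x`, so `z • 1 = 1` by nondegeneracy. -/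
theorem IsSeparableAlgebra.projective_env (h : IsSeparableAlgebra k A) :
    Module.Projective (Env k A) A := by
  have := h.finite
  obtain ⟨a, ha⟩ := h.exists_twistedTrace_nondegenerate
  obtain ⟨z, hz, hc⟩ := exists_central_envToEnd ha a
  refine projective_env_iff.2 ⟨z, hc, sub_eq_zero.1 (ha _ fun x ↦ ?_)⟩
  rw [sub_mul, map_sub, apply_smul_one_mul (twistedTrace_mul_comm k a), hz, one_mul, sub_eq_zero,
    twistedTrace_apply]
  congr 1
  ext; simp [mul_assoc]

/-- For a symmetric algebra `A`, bimodule maps from `A` to `A^e` are identified with `A`. -/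
def homEnvEquiv [Module.Finite k A] (h : ∀ x, (∀ y, t (x * y) = 0) → x = 0) :
    (A →ₗ[Env k A] Env k A) ≃+ A :=
  AddEquiv.ofBijective
    (⟨⟨fun g ↦ envToEnd t (g 1) 1, by simp⟩, fun f g ↦ by simp⟩ :
      (A →ₗ[Env k A] Env k A) →+ A) <| by
    constructor
    · refine (injective_iff_map_eq_zero _).2 fun g hg ↦ ?_
      replace hg : envToEnd t (g 1) 1 = 0 := hg
      have h1 : g 1 = 0 := (envToEnd_bijective h).1 <| LinearMap.ext fun b ↦ by
        rw [map_zero, LinearMap.zero_apply, ← mul_one b, ← envToEnd_right_mul,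
          ← hom_env_one_central, envToEnd_left_mul, hg, mul_zero]
      ext x
      rw [hom_env_apply, h1, mul_zero, LinearMap.zero_apply]
    · intro a
      obtain ⟨z, hz, hc⟩ := exists_central_envToEnd h a
      refine ⟨homOfCentral z hc, ?_⟩
      change envToEnd t (homOfCentral z hc 1) 1 = a
      rw [homOfCentral_one, hz]
      simp

theorem homEnvEquiv_apply [Module.Finite k A] (h : ∀ x, (∀ y, t (x * y) = 0) → x = 0)
    (g : A →ₗ[Env k A] Env k A) : homEnvEquiv h g = envToEnd t (g 1) 1 := rfl

/-- If `g 1` corresponds to right multiplication by `a`, then multiplying it on the right by the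
swap of `c ⊗ d` and evaluating at `1` gives `c a d`. -/
theorem homEnvEquiv_smul [Module.Finite k A] (ht : ∀ x y, t (x * y) = t (y * x))
    (h : ∀ x, (∀ y, t (x * y) = 0) → x = 0) (g : A →ₗ[Env k A] Env k A) (r : Env k A) :
    homEnvEquiv h (LinearMap.toSpanSingleton (Env k A) (Env k A) (envSwap k A r) ∘ₗ g) =
      r • homEnvEquiv h g := by
  rw [homEnvEquiv_apply, homEnvEquiv_apply]
  change envToEnd t (g 1 * envSwap k A r) 1 = _
  induction r using TensorProduct.induction_on with
  | zero => rw [env_zero_smul]; simp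
  | add r s hr hs => rw [map_add, mul_add, map_add, LinearMap.add_apply, hr, hs, add_smul]
  | tmul c d =>
    rw [envSwap_tmul, envToEnd_mul_tmul ht, env_tmul_smul, ← mul_one c, ← envToEnd_right_mul,
      ← hom_env_one_central, envToEnd_left_mul, mul_one]

end Form

/-! ### Vanishing of extension groups and finite resolutions -/

section Resolution

variable {R : Type v} [Ring R]

/-- Extension classes with values in a finitely generated projective module are determined by
their coordinates. -/
theorem ext_eq_sum_of_dualBasis {X : ModuleCat.{v} R} {M : Type v} [AddCommGroup M] [Module R M]
    {ι : Type*} [Fintype ι] {c : ι → M →ₗ[R] R} {e : ι → M} (h : ∀ m, ∑ j, c j m • e j = m)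
    {i : ℕ} (x : Abelian.Ext.{v} X (ModuleCat.of R M) i) :
    x = ∑ j, (x.comp (Abelian.Ext.mk₀ (ModuleCat.ofHom (c j))) (add_zero i)).comp
      (Abelian.Ext.mk₀ (ModuleCat.ofHom (LinearMap.toSpanSingleton R M (e j)))) (add_zero i) := by
  have h : 𝟙 (ModuleCat.of R M) = ∑ j, ModuleCat.ofHom (c j) ≫
      ModuleCat.ofHom (LinearMap.toSpanSingleton R M (e j)) := by
    refine ModuleCat.hom_ext (LinearMap.ext fun y ↦ ?_)
    rw [ModuleCat.hom_sum, LinearMap.sum_apply]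
    exact (h y).symm
  conv_lhs => rw [← x.comp_mk₀_id, h, Abelian.Ext.mk₀_sum, Abelian.Ext.comp_sum]
  refine Finset.sum_congr rfl fun j _ ↦ ?_
  rw [Abelian.Ext.comp_assoc_of_third_deg_zero, Abelian.Ext.mk₀_comp_mk₀]

/-- An explicit form of `Ext(X, M) = Ext(X, R) ⊗_R M`: it moves the coefficients `ρ` from the
classes `s l` into `M`, where `g` may kill the resulting elements. -/
theorem ext_comp_eq_sum_of_dualBasis {X : ModuleCat.{v} R} {M M' : Type v} [AddCommGroup M]
    [Module R M] [AddCommGroup M'] [Module R M'] {ι κ : Type*} [Fintype ι] [Fintype κ]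
    {c : ι → M →ₗ[R] R} {e : ι → M} (h : ∀ m, ∑ j, c j m • e j = m) {i : ℕ}
    (x : Abelian.Ext.{v} X (ModuleCat.of R M) i) (s : κ → Abelian.Ext.{v} X (ModuleCat.of R R) i)
    (ρ : κ → ι → R) (hx : ∀ j, x.comp (Abelian.Ext.mk₀ (ModuleCat.ofHom (c j))) (add_zero i) =
      ∑ l, (s l).comp (Abelian.Ext.mk₀ (rightMul R (ρ l j))) (add_zero i)) (g : M →ₗ[R] M') :
    x.comp (Abelian.Ext.mk₀ (ModuleCat.ofHom g)) (add_zero i) =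
      ∑ l, (s l).comp (Abelian.Ext.mk₀ (ModuleCat.ofHom
        (LinearMap.toSpanSingleton R M' (g (∑ j, ρ l j • e j))))) (add_zero i) := by
  conv_lhs => rw [ext_eq_sum_of_dualBasis h x, Abelian.Ext.sum_comp]
  simp only [hx, Abelian.Ext.sum_comp]
  rw [Finset.sum_comm]
  refine Finset.sum_congr rfl fun l _ ↦ ?_
  simp only [Abelian.Ext.comp_assoc_of_third_deg_zero, Abelian.Ext.mk₀_comp_mk₀]
  rw [← Abelian.Ext.comp_sum, ← Abelian.Ext.mk₀_sum]
  congr 2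
  refine ModuleCat.hom_ext (LinearMap.ext fun t ↦ ?_)
  rw [ModuleCat.hom_sum, LinearMap.sum_apply]
  change ∑ j, g ((t * ρ l j) • e j) = t • g (∑ j, ρ l j • e j)
  rw [← map_smul, Finset.smul_sum, map_sum]
  simp only [mul_smul]

theorem subsingleton_ext_of_dualBasis {X : ModuleCat.{v} R} {i : ℕ}
    (hX : Subsingleton (Abelian.Ext.{v} X (ModuleCat.of R R) i)) {M : Type v} [AddCommGroup M]
    [Module R M] {ι : Type*} [Fintype ι] {c : ι → M →ₗ[R] R} {e : ι → M}
    (h : ∀ m, ∑ j, c j m • e j = m) : Subsingleton (Abelian.Ext.{v} X (ModuleCat.of R M) i) := by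
  refine subsingleton_of_forall_eq 0 fun x ↦ ?_
  rw [ext_eq_sum_of_dualBasis h x]
  refine Finset.sum_eq_zero fun j _ ↦ ?_
  rw [hX.elim (x.comp _ _) 0, Abelian.Ext.zero_comp]

theorem subsingleton_ext_pi {X : ModuleCat.{v} R} {q i : ℕ}
    (h : Subsingleton (Abelian.Ext.{v} X (ModuleCat.of R R) i)) :
    Subsingleton (Abelian.Ext.{v} X (ModuleCat.of R (Fin q → R)) i) :=
  subsingleton_ext_of_dualBasis h (c := fun j ↦ LinearMap.proj j) (e := fun j ↦ Pi.single j 1)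
    fun m ↦ by
      conv_rhs => rw [← Finset.univ_sum_single m]
      refine Finset.sum_congr rfl fun j _ ↦ ?_
      rw [LinearMap.proj_apply, ← Pi.single_smul, smul_eq_mul, mul_one]

/-- Vanishing in degree `i + 1` makes `Ext^i(X, -)` right exact, so classes lift along a surjection
from a finite free module. -/
theorem subsingleton_ext_of_finite {X : ModuleCat.{v} R} {i : ℕ}
    (h : Subsingleton (Abelian.Ext.{v} X (ModuleCat.of R R) i))
    (h' : ∀ M : ModuleCat.{v} R, Subsingleton (Abelian.Ext.{v} X M (i + 1)))
    (F : Type v) [AddCommGroup F] [Module R F] [Module.Finite R F] :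
    Subsingleton (Abelian.Ext.{v} X (ModuleCat.of R F) i) := by
  obtain ⟨q, f, hf⟩ := Module.Finite.exists_fin' R F
  refine subsingleton_of_forall_eq 0 fun x ↦ ?_
  obtain ⟨y, rfl⟩ := Abelian.Ext.covariant_sequence_exact₃ X
    (LinearMap.shortExact_shortComplexKer hf) x rfl ((h' _).elim _ _)
  rw [(subsingleton_ext_pi h).elim y 0, Abelian.Ext.zero_comp]

/-- `X` has a resolution of length `n` by finitely generated projective modules. -/
def HasFiniteResolution (R : Type v) [Ring R] : ℕ → ∀ (X : Type v) [AddCommGroup X] [Module R X],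
    Prop
  | 0, X, _, _ => Module.Finite R X ∧ Module.Projective R X
  | n + 1, X, _, _ => ∃ (P : Type v) (_ : AddCommGroup P) (_ : Module R P) (f : P →ₗ[R] X),
      Function.Surjective f ∧ Module.Finite R P ∧ Module.Projective R P ∧
        HasFiniteResolution R n (LinearMap.ker f)

theorem HasFiniteResolution.finite {n : ℕ} {X : Type v} [AddCommGroup X] [Module R X]
    (h : HasFiniteResolution R n X) : Module.Finite R X := by
  cases n with
  | zero => exact h.1
  | succ n =>
    obtain ⟨P, _, _, f, hf, _, _, _⟩ := h
    exact Module.Finite.of_surjective f hf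

/-- Induction on the length, shifting degrees to the first syzygy `K`. Only degree 1 with `m = 0`
escapes the shift: there every class factors through the extension class in `Ext^1(X, K)`, which is
zero because `K` is finitely generated. -/
theorem subsingleton_ext_of_hasFiniteResolution {n m : ℕ} {X : Type v} [AddCommGroup X]
    [Module R X] (h : HasFiniteResolution R n X)
    (hX : ∀ i, m < i → Subsingleton
      (Abelian.Ext.{v} (ModuleCat.of R X) (ModuleCat.of R R) i)) (i : ℕ) (hi : m < i)
    (M : ModuleCat.{v} R) : Subsingleton (Abelian.Ext.{v} (ModuleCat.of R X) M i) := by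
  induction n generalizing m X i M with
  | zero =>
    have := h.2
    obtain ⟨j, rfl⟩ : ∃ j, i = j + 1 := ⟨i - 1, by lia⟩
    exact Abelian.Ext.subsingleton_of_projective _ _ _
  | succ n ih =>
    obtain ⟨P, _, _, f, hf, _, _, hK⟩ := h
    have hS := LinearMap.shortExact_shortComplexKer hf
    -- For `m = 0` the truncated subtraction leaves the bound at `0`, which keeps the degrees
    -- positive where `P` has no `Ext`.
    have hK' : ∀ i, m - 1 < i → ∀ M : ModuleCat.{v} R, Subsingleton
        (Abelian.Ext.{v} (ModuleCat.of R (LinearMap.ker f)) M i) := by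
      refine ih hK fun i hi ↦ subsingleton_of_forall_eq 0 fun y ↦ ?_
      obtain ⟨x, rfl⟩ := Abelian.Ext.contravariant_sequence_exact₁ hS _ y rfl
        ((hX (1 + i) (by lia)).elim _ _)
      obtain ⟨j, rfl⟩ : ∃ j, i = j + 1 := ⟨i - 1, by lia⟩
      rw [(Abelian.Ext.subsingleton_of_projective (ModuleCat.of R P) _ j).elim x 0,
        Abelian.Ext.comp_zero]
    have key : ∀ i, m < i → 1 < i → ∀ M : ModuleCat.{v} R,
        Subsingleton (Abelian.Ext.{v} (ModuleCat.of R X) M i) := by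
      intro i hi hi1 M
      obtain ⟨j, rfl⟩ : ∃ j, i = j + 1 := ⟨i - 1, by lia⟩
      refine subsingleton_of_forall_eq 0 fun x ↦ ?_
      obtain ⟨y, rfl⟩ := precomp_extClass_surjective_of_projective_X₂ M hS j x
      rw [(hK' j (by lia) M).elim y 0, map_zero]
    rcases lt_or_ge 1 i with hi1 | hi1
    · exact key i hi hi1 M
    · obtain rfl : i = 0 + 1 := by lia
      have := hK.finite
      have h0 := subsingleton_ext_of_finite (hX 1 hi) (key 2 (by lia) (by lia)) (LinearMap.ker f)
      refine subsingleton_of_forall_eq 0 fun x ↦ ?_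
      obtain ⟨y, rfl⟩ := precomp_extClass_surjective_of_projective_X₂ M hS 0 x
      change hS.extClass.comp y (add_comm 1 0) = 0
      rw [h0.elim hS.extClass 0, Abelian.Ext.zero_comp]

theorem projective_of_hasFiniteResolution {n : ℕ} {X : Type v} [AddCommGroup X]
    [Module R X] (h : HasFiniteResolution R n X)
    (hX : ∀ i, 0 < i → Subsingleton
      (Abelian.Ext.{v} (ModuleCat.of R X) (ModuleCat.of R R) i)) : Module.Projective R X := by
  rw [IsProjective.iff_projective, projective_iff_subsingleton_ext_one]
  exact fun M ↦ subsingleton_ext_of_hasFiniteResolution h hX 1 one_pos M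

theorem ker_codRestrict_eq {M N : Type v} [AddCommGroup M] [Module R M] [AddCommGroup N]
    [Module R N] {L : Submodule R N} (f : M →ₗ[R] N) (h : LinearMap.range f = L) :
    ∃ g : M →ₗ[R] L, Function.Surjective g ∧ LinearMap.ker g = LinearMap.ker f := by
  subst h
  exact ⟨f.rangeRestrict, f.surjective_rangeRestrict, f.ker_rangeRestrict⟩

theorem HasFiniteResolution.of_isPerfectModule {X : Type v} [AddCommGroup X] [Module R X]
    (h : IsPerfectModule R X) : ∃ n, HasFiniteResolution R n X := by
  obtain ⟨P, hP, n, hn⟩ := h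
  have hproj (i : ℕ) : Module.Projective R (P.complex.X i) :=
    (IsProjective.iff_projective _).2 (P.projective i)
  -- `j` counts the remaining length. At `j = 0` the kernel lies in a term of index greater than
  -- `n`, hence is zero.
  have key (j : ℕ) : ∀ i, n ≤ i + j →
      HasFiniteResolution R j (LinearMap.ker (P.complex.d (i + 1) i).hom) := by
    induction j with
    | zero =>
      intro i hi
      have := hn (i + 1) (by lia)
      exact ⟨inferInstance, inferInstance⟩
    | succ j ih =>
      intro i hi
      obtain ⟨g, hg, hk⟩ := ker_codRestrict_eq (P.complex.d (i + 2) (i + 1)).hom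
        (P.exact_succ i).moduleCat_range_eq_ker
      refine ⟨P.complex.X (i + 2), _, _, g, hg, hP _, hproj _, ?_⟩
      rw [hk]
      exact ih (i + 1) (by lia)
  have h0 : HasFiniteResolution R (n + 1) (LinearMap.ker (P.π.f 0).hom) := by
    obtain ⟨g, hg, hk⟩ := ker_codRestrict_eq (P.complex.d 1 0).hom P.exact₀.moduleCat_range_eq_ker
    refine ⟨P.complex.X 1, inferInstance, inferInstance, g, hg, hP _, hproj _, ?_⟩
    rw [hk]
    exact key n 0 (by lia)
  have h1 : HasFiniteResolution R (n + 2) (((ChainComplex.single₀ _).obj (ModuleCat.of R X)).X 0) :=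
    ⟨P.complex.X 0, inferInstance, inferInstance, (P.π.f 0).hom,
      (ModuleCat.epi_iff_surjective (P.π.f 0)).1 inferInstance, hP 0, hproj 0, h0⟩
  exact ⟨n + 2, h1⟩

theorem IsPerfectModule.of_projective {X : Type v} [AddCommGroup X] [Module R X]
    [Module.Finite R X] [Module.Projective R X] : IsPerfectModule R X := by
  refine ⟨ProjectiveResolution.self (ModuleCat.of R X), fun i ↦ ?_, 0, fun i hi ↦ ?_⟩
  · cases i with
    | zero => exact inferInstanceAs (Module.Finite R X)
    | succ i =>
      have : Subsingleton ((ProjectiveResolution.self (ModuleCat.of R X)).complex.X (i + 1)) :=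
        ModuleCat.subsingleton_of_isZero (HomologicalComplex.isZero_single_obj_X _ _ _ _ (by simp))
      exact Module.Finite.of_finite
  · exact ModuleCat.subsingleton_of_isZero
      (HomologicalComplex.isZero_single_obj_X _ _ _ _ (by lia))

end Resolution

/-! ### Invertible bimodules -/

section Action

variable {k : Type u} {A : Type v} [Field k] [Ring A] [Algebra k A]
variable {U : Type v} [AddCommGroup U] [Module (Env k A) U]

theorem add_tmul_one_smul (a b : A) (x : U) : ((a + b) ⊗ₜ[k] 1 : Env k A) • x =
    (a ⊗ₜ[k] 1 : Env k A) • x + (b ⊗ₜ[k] 1 : Env k A) • x := by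
  rw [TensorProduct.add_tmul, add_smul]

theorem zero_tmul_one_smul (x : U) : ((0 : A) ⊗ₜ[k] 1 : Env k A) • x = 0 := by
  rw [TensorProduct.zero_tmul]; exact zero_smul (Env k A) x

theorem one_tmul_one_smul (x : U) : ((1 : A) ⊗ₜ[k] 1 : Env k A) • x = x :=
  one_smul (Env k A) x

theorem mul_tmul_one_smul (a b : A) (x : U) : ((a * b) ⊗ₜ[k] 1 : Env k A) • x =
    (a ⊗ₜ[k] 1 : Env k A) • (b ⊗ₜ[k] 1 : Env k A) • x := by
  rw [smul_smul]; simp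

theorem one_tmul_op_add_smul (a b : A) (x : U) : (1 ⊗ₜ[k] op (a + b) : Env k A) • x =
    (1 ⊗ₜ[k] op a : Env k A) • x + (1 ⊗ₜ[k] op b : Env k A) • x := by
  rw [MulOpposite.op_add, TensorProduct.tmul_add, add_smul]

theorem one_tmul_op_zero_smul (x : U) : (1 ⊗ₜ[k] op (0 : A) : Env k A) • x = 0 := by
  rw [op_zero, TensorProduct.tmul_zero]; exact zero_smul (Env k A) x

theorem one_tmul_op_mul_smul (a b : A) (x : U) : (1 ⊗ₜ[k] op (a * b) : Env k A) • x =
    (1 ⊗ₜ[k] op b : Env k A) • (1 ⊗ₜ[k] op a : Env k A) • x := by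
  rw [smul_smul]; simp

theorem left_smul_right_smul (a b : A) (x : U) :
    (a ⊗ₜ[k] 1 : Env k A) • (1 ⊗ₜ[k] op b : Env k A) • x =
      (1 ⊗ₜ[k] op b : Env k A) • (a ⊗ₜ[k] 1 : Env k A) • x := by
  rw [smul_smul, smul_smul]; simp

end Action

section Tensor

variable {k : Type u} {A : Type v} [Field k] [Ring A] [Algebra k A]
variable {U V : Type v} [AddCommGroup U] [Module k U] [AddCommGroup V] [Module k V]

@[elab_as_elim]
theorem OuterTensor.induction {motive : OuterTensor k U V → Prop} (s : OuterTensor k U V)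
    (zero : motive 0) (mk : ∀ x y, motive (OuterTensor.mk x y))
    (add : ∀ s t, motive s → motive t → motive (s + t)) : motive s :=
  TensorProduct.induction_on s zero mk add

theorem OuterTensor.mk_add_left (x y : U) (z : V) :
    (OuterTensor.mk (x + y) z : OuterTensor k U V) = OuterTensor.mk x z + OuterTensor.mk y z :=
  TensorProduct.add_tmul _ _ _

theorem OuterTensor.mk_add_right (x : U) (y z : V) :
    (OuterTensor.mk x (y + z) : OuterTensor k U V) = OuterTensor.mk x y + OuterTensor.mk x z :=
  TensorProduct.tmul_add _ _ _

theorem OuterTensor.mk_zero_left (z : V) : (OuterTensor.mk 0 z : OuterTensor k U V) = 0 :=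
  TensorProduct.zero_tmul _ _

theorem OuterTensor.mk_zero_right (x : U) : (OuterTensor.mk x 0 : OuterTensor k U V) = 0 :=
  TensorProduct.tmul_zero _ _

variable [Module (Env k A) U] [IsScalarTower k (Env k A) U]
variable [Module (Env k A) V] [IsScalarTower k (Env k A) V]

/-- An additive map that is balanced on pure tensors vanishes on `balancing`. -/
theorem eq_zero_of_mem_balancing {X : Type*} [AddCommGroup X] (f : OuterTensor k U V →+ X)
    (hf : ∀ (x : U) (a : A) (y : V), f (OuterTensor.mk ((1 ⊗ₜ[k] op a : Env k A) • x) y) =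
      f (OuterTensor.mk x ((a ⊗ₜ[k] 1 : Env k A) • y)))
    (t : OuterTensor k U V) (ht : t ∈ balancing k A U V) : f t = 0 := by
  -- `f` is only additive while `balancing` is an `A^e`-span, so the claim is strengthened to be
  -- stable under scalars.
  suffices h : ∀ r : Env k A, f (r • t) = 0 by simpa using h 1
  induction ht using Submodule.span_induction with
  | zero => intro r; rw [smul_zero, map_zero]
  | add s t _ _ hs ht => intro r; rw [smul_add, map_add, hs, ht, add_zero]
  | smul r t _ ht => intro r'; rw [smul_smul, ht]
  | mem t ht =>
    obtain ⟨x, a, y, rfl⟩ := ht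
    intro r
    induction r using TensorProduct.induction_on with
    | zero => exact (congrArg f (zero_smul (Env k A) _)).trans (map_zero f)
    | add r s hr hs => rw [add_smul, map_add, hr, hs, add_zero]
    | tmul b c =>
      rw [smul_sub, outerTensor_smul_mk, outerTensor_smul_mk, map_sub, sub_eq_zero, smul_smul,
        smul_smul]
      have h1 : (b ⊗ₜ[k] 1 : Env k A) * 1 ⊗ₜ[k] op a = 1 ⊗ₜ[k] op a * b ⊗ₜ[k] 1 := by simp
      have h2 : (1 ⊗ₜ[k] c : Env k A) * a ⊗ₜ[k] 1 = a ⊗ₜ[k] 1 * 1 ⊗ₜ[k] c := by simp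
      rw [h1, h2, ← smul_smul, ← smul_smul, hf]

theorem smul_eq_left_smul (c : k) (x : U) :
    c • x = (algebraMap k A c ⊗ₜ[k] 1 : Env k A) • x := by
  rw [← one_smul (Env k A) x, ← smul_assoc, one_smul]
  congr 1
  rw [Algebra.TensorProduct.one_def, TensorProduct.smul_tmul', Algebra.algebraMap_eq_smul_one]

theorem smul_eq_right_smul (c : k) (x : U) :
    c • x = (1 ⊗ₜ[k] op (algebraMap k A c) : Env k A) • x := by
  rw [← one_smul (Env k A) x, ← smul_assoc, one_smul]
  congr 1
  rw [Algebra.TensorProduct.one_def, ← TensorProduct.tmul_smul, Algebra.algebraMap_eq_smul_one,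
    op_smul, op_one]

theorem map_mk_left_smul (φ : OuterTensor k U V →ₗ[Env k A] A) (a : A) (x : U) (y : V) :
    φ (OuterTensor.mk ((a ⊗ₜ[k] 1 : Env k A) • x) y) = a * φ (OuterTensor.mk x y) := by
  have h := outerTensor_smul_mk k A U V a 1 x y
  have h1 : (1 ⊗ₜ[k] 1 : Env k A) • y = y := one_smul (Env k A) y
  rw [h1] at h
  rw [← h, map_smul, env_tmul_smul, unop_one, mul_one]

theorem map_mk_right_smul (φ : OuterTensor k U V →ₗ[Env k A] A) (a : A) (x : U) (y : V) :
    φ (OuterTensor.mk x ((1 ⊗ₜ[k] op a : Env k A) • y)) = φ (OuterTensor.mk x y) * a := by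
  have h := outerTensor_smul_mk k A U V 1 (op a) x y
  rw [one_tmul_one_smul] at h
  rw [← h, map_smul, env_tmul_smul, unop_op, one_mul]

/-- The map `V ⊗ U → U`, `v ⊗ w ↦ φ (x ⊗ v) w`. -/
def leftEval (φ : OuterTensor k U V →ₗ[Env k A] A) (x : U) : OuterTensor k V U →+ U :=
  TensorProduct.liftAddHom
    { toFun v :=
        { toFun w := (φ (OuterTensor.mk x v) ⊗ₜ[k] 1 : Env k A) • w
          map_zero' := smul_zero _
          map_add' := smul_add _ }
      map_zero' := by
        ext w
        change (φ (OuterTensor.mk x 0) ⊗ₜ[k] 1 : Env k A) • w = 0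
        rw [OuterTensor.mk_zero_right, map_zero, zero_tmul_one_smul]
      map_add' v v' := by
        ext w
        change (φ (OuterTensor.mk x (v + v')) ⊗ₜ[k] 1 : Env k A) • w =
          (φ (OuterTensor.mk x v) ⊗ₜ[k] 1 : Env k A) • w +
            (φ (OuterTensor.mk x v') ⊗ₜ[k] 1 : Env k A) • w
        rw [OuterTensor.mk_add_right, map_add, add_tmul_one_smul] }
    fun c v w ↦ by
      change (φ (OuterTensor.mk x (c • v)) ⊗ₜ[k] 1 : Env k A) • w =
        (φ (OuterTensor.mk x v) ⊗ₜ[k] 1 : Env k A) • c • w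
      rw [smul_eq_right_smul (A := A) c v, smul_eq_left_smul (A := A) c w, map_mk_right_smul,
        mul_tmul_one_smul]

theorem leftEval_mk (φ : OuterTensor k U V →ₗ[Env k A] A) (x w : U) (v : V) :
    leftEval φ x (OuterTensor.mk v w) = (φ (OuterTensor.mk x v) ⊗ₜ[k] 1 : Env k A) • w := rfl

/-- The map `U ⊗ V → U`, `x ⊗ v ↦ x ψ (v ⊗ w)`. -/
def rightEval (ψ : OuterTensor k V U →ₗ[Env k A] A) (w : U) : OuterTensor k U V →+ U :=
  TensorProduct.liftAddHom
    { toFun x :=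
        { toFun v := (1 ⊗ₜ[k] op (ψ (OuterTensor.mk v w)) : Env k A) • x
          map_zero' := by rw [OuterTensor.mk_zero_left, map_zero, one_tmul_op_zero_smul]
          map_add' v v' := by rw [OuterTensor.mk_add_left, map_add, one_tmul_op_add_smul] }
      map_zero' := by
        ext v
        exact smul_zero _
      map_add' x x' := by
        ext v
        exact smul_add _ _ _ }
    fun c x v ↦ by
      change (1 ⊗ₜ[k] op (ψ (OuterTensor.mk v w)) : Env k A) • c • x =
        (1 ⊗ₜ[k] op (ψ (OuterTensor.mk (c • v) w)) : Env k A) • x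
      rw [smul_eq_left_smul (A := A) c v, smul_eq_right_smul (A := A) c x, map_mk_left_smul,
        one_tmul_op_mul_smul]

theorem rightEval_mk (ψ : OuterTensor k V U →ₗ[Env k A] A) (x w : U) (v : V) :
    rightEval ψ w (OuterTensor.mk x v) = (1 ⊗ₜ[k] op (ψ (OuterTensor.mk v w)) : Env k A) • x := rfl

/-- `leftEval` is balanced, so it factors through `V ⊗_A U`, where `ψ` detects equality. -/
theorem leftEval_eq_of_eq {φ : OuterTensor k U V →ₗ[Env k A] A}
    {ψ : OuterTensor k V U →ₗ[Env k A] A}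
    (hψ : LinearMap.ker ψ ≤ balancing k A V U)
    (x : U) {s t : OuterTensor k V U} (h : ψ s = ψ t) : leftEval φ x s = leftEval φ x t := by
  rw [← sub_eq_zero, ← map_sub]
  refine eq_zero_of_mem_balancing _ (fun v a w ↦ ?_) _ (hψ (LinearMap.sub_mem_ker_iff.2 h))
  rw [leftEval_mk, leftEval_mk, map_mk_right_smul, mul_tmul_one_smul]

theorem leftEval_right_smul (φ : OuterTensor k U V →ₗ[Env k A] A) (x : U) (c : A)
    (s : OuterTensor k V U) : leftEval φ x ((1 ⊗ₜ[k] op c : Env k A) • s) =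
      (1 ⊗ₜ[k] op c : Env k A) • leftEval φ x s := by
  induction s using OuterTensor.induction with
  | zero => rw [smul_zero, map_zero, smul_zero]
  | add s t hs ht => rw [smul_add, map_add, hs, ht, map_add, smul_add]
  | mk v w =>
    rw [outerTensor_smul_mk, one_tmul_one_smul, leftEval_mk, leftEval_mk, left_smul_right_smul]

theorem leftEval_add_left (φ : OuterTensor k U V →ₗ[Env k A] A) (x y : U)
    (s : OuterTensor k V U) : leftEval φ (x + y) s = leftEval φ x s + leftEval φ y s := by
  induction s using OuterTensor.induction with
  | zero => simp
  | add s t hs ht => rw [map_add, hs, ht, map_add, map_add]; abel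
  | mk v w =>
    rw [leftEval_mk, leftEval_mk, leftEval_mk, OuterTensor.mk_add_left, map_add, add_tmul_one_smul]

theorem leftEval_left_smul (φ : OuterTensor k U V →ₗ[Env k A] A) (x : U) (c : A)
    (s : OuterTensor k V U) : leftEval φ ((c ⊗ₜ[k] 1 : Env k A) • x) s =
      (c ⊗ₜ[k] 1 : Env k A) • leftEval φ x s := by
  induction s using OuterTensor.induction with
  | zero => simp
  | add s t hs ht => rw [map_add, hs, ht, map_add, smul_add]
  | mk v w => rw [leftEval_mk, leftEval_mk, map_mk_left_smul, mul_tmul_one_smul]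

theorem leftEval_smul_right {φ : OuterTensor k U V →ₗ[Env k A] A}
    (hφ : balancing k A U V ≤ LinearMap.ker φ) (x : U) (c : A) (s : OuterTensor k V U) :
    leftEval φ ((1 ⊗ₜ[k] op c : Env k A) • x) s = leftEval φ x ((c ⊗ₜ[k] 1 : Env k A) • s) := by
  induction s using OuterTensor.induction with
  | zero => simp
  | add s t hs ht => rw [map_add, hs, ht, smul_add, map_add]
  | mk v w =>
    have h := outerTensor_smul_mk k A V U c 1 v w
    have h1 : (1 ⊗ₜ[k] 1 : Env k A) • w = w := one_smul (Env k A) w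
    rw [h1] at h
    rw [h, leftEval_mk, leftEval_mk]
    congr 2
    rw [← sub_eq_zero, ← map_sub]
    exact hφ (Submodule.subset_span ⟨x, c, v, rfl⟩)

/-- An invertible bimodule is a finitely generated projective left module. -/
theorem IsInvertibleBimodule.exists_dualBasis (h : IsInvertibleBimodule k A U) :
    ∃ (ι : Type v) (_ : Fintype ι) (f : ι → U →+ A) (s : ι → U),
      (∀ i a x, f i ((a ⊗ₜ[k] 1 : Env k A) • x) = a * f i x) ∧
        ∀ x, ∑ i, (f i x ⊗ₜ[k] 1 : Env k A) • s i = x := by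
  obtain ⟨V, _, _, _, _, ⟨e₁⟩, ⟨e₂⟩⟩ := h
  let φ : OuterTensor k U V →ₗ[Env k A] A := e₁.toLinearMap ∘ₗ (balancing k A U V).mkQ
  let ψ : OuterTensor k V U →ₗ[Env k A] A := e₂.toLinearMap ∘ₗ (balancing k A V U).mkQ
  have hφ : LinearMap.ker φ = balancing k A U V := by
    rw [LinearEquiv.ker_comp, Submodule.ker_mkQ]
  have hψ : LinearMap.ker ψ = balancing k A V U := by
    rw [LinearEquiv.ker_comp, Submodule.ker_mkQ]
  obtain ⟨s₁, hs₁⟩ : ∃ s, φ s = 1 := (e₁.surjective.comp (Submodule.mkQ_surjective _)) 1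
  obtain ⟨s₂, hs₂⟩ : ∃ s, ψ s = 1 := (e₂.surjective.comp (Submodule.mkQ_surjective _)) 1
  -- The two isomorphisms need not be compatible; `α` measures the defect, through `φ(x ⊗ v) w =
  -- α(x) ψ(v ⊗ w)`. It is shown to be a bimodule automorphism.
  let α : U →+ U :=
    { toFun x := leftEval φ x s₂
      map_zero' := by simpa using leftEval_add_left φ 0 0 s₂
      map_add' x y := leftEval_add_left φ x y s₂ }
  have hα (x : U) : α x = leftEval φ x s₂ := rfl
  have heval (x : U) (t : OuterTensor k V U) :
      leftEval φ x t = (1 ⊗ₜ[k] op (ψ t) : Env k A) • α x := by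
    rw [hα, ← leftEval_right_smul]
    refine leftEval_eq_of_eq hψ.le x ?_
    rw [map_smul, hs₂, env_one_tmul_smul_one]
  have hαr (x : U) (c : A) :
      α ((1 ⊗ₜ[k] op c : Env k A) • x) = (1 ⊗ₜ[k] op c : Env k A) • α x := by
    rw [hα, leftEval_smul_right hφ.ge, heval, map_smul, hs₂, env_tmul_one_smul_one]
  have hαl (x : U) (c : A) :
      α ((c ⊗ₜ[k] 1 : Env k A) • x) = (c ⊗ₜ[k] 1 : Env k A) • α x := leftEval_left_smul φ x c s₂
  -- If `α x = 0`, then `φ(x ⊗ v)` annihilates `U`, hence annihilates `1 = φ(s₁)`. So `x ⊗ v` is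
  -- zero over `A`, giving `x ψ(v ⊗ w) = 0` and finally `x = 0`.
  have hinj : Function.Injective α := by
    refine (injective_iff_map_eq_zero _).2 fun x hx ↦ ?_
    have h1 (v : V) : φ (OuterTensor.mk x v) = 0 := by
      have h2 (t : OuterTensor k U V) : φ (OuterTensor.mk x v) * φ t = 0 := by
        induction t using OuterTensor.induction with
        | zero => rw [map_zero, mul_zero]
        | add s t hs ht => rw [map_add, mul_add, hs, ht, add_zero]
        | mk w v' => rw [← map_mk_left_smul, ← leftEval_mk, heval, hx, smul_zero,
            OuterTensor.mk_zero_left, map_zero]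
      simpa [hs₁] using h2 s₁
    have h3 (t : OuterTensor k V U) : (1 ⊗ₜ[k] op (ψ t) : Env k A) • x = 0 := by
      induction t using OuterTensor.induction with
      | zero => rw [map_zero, one_tmul_op_zero_smul]
      | add s t hs ht => rw [map_add, one_tmul_op_add_smul, hs, ht, add_zero]
      | mk v w =>
        rw [← rightEval_mk]
        refine eq_zero_of_mem_balancing _ (fun y a v ↦ ?_) _ (hφ.le (h1 v))
        rw [rightEval_mk, rightEval_mk, map_mk_left_smul, one_tmul_op_mul_smul]
    simpa [hs₂, one_tmul_one_smul] using h3 s₂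
  -- `φ(y ⊗ v) x = α(y ψ(v ⊗ x))`, and `1` is a value of `φ`.
  have hsurj : Function.Surjective α := by
    intro x
    have h1 (t : OuterTensor k U V) : ∃ y, α y = (φ t ⊗ₜ[k] 1 : Env k A) • x := by
      induction t using OuterTensor.induction with
      | zero => exact ⟨0, by rw [map_zero, map_zero, zero_tmul_one_smul]⟩
      | add s t hs ht =>
        obtain ⟨y, hy⟩ := hs
        obtain ⟨z, hz⟩ := ht
        exact ⟨y + z, by rw [map_add, map_add, hy, hz, add_tmul_one_smul]⟩
      | mk y v =>
        refine ⟨(1 ⊗ₜ[k] op (ψ (OuterTensor.mk v x)) : Env k A) • y, ?_⟩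
        rw [hαr, ← heval, leftEval_mk]
    obtain ⟨y, hy⟩ := h1 s₁
    exact ⟨y, by rw [hy, hs₁, one_tmul_one_smul]⟩
  let β := (AddEquiv.ofBijective α ⟨hinj, hsurj⟩).symm
  have hβ (x : U) : α (β x) = x := (AddEquiv.ofBijective α ⟨hinj, hsurj⟩).apply_symm_apply x
  -- Writing `s₂ = ∑ v ⊗ w`, the identity `x = α(β x) = ∑ φ(β x ⊗ v) w` is the dual basis.
  obtain ⟨S, hS⟩ := TensorProduct.exists_finset (R := k) (M := V) (N := U) s₂
  let f (i : V) : U →+ A :=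
    { toFun x := φ (OuterTensor.mk x i)
      map_zero' := by rw [OuterTensor.mk_zero_left, map_zero]
      map_add' x y := by rw [OuterTensor.mk_add_left, map_add] }
  refine ⟨S, inferInstance, fun i ↦ (f i.1.1).comp β.toAddMonoidHom, fun i ↦ i.1.2,
    fun i a x ↦ ?_, fun x ↦ ?_⟩
  · have : β ((a ⊗ₜ[k] 1 : Env k A) • x) = (a ⊗ₜ[k] 1 : Env k A) • β x :=
      hinj (by rw [hβ, hαl, hβ])
    change φ (OuterTensor.mk (β _) _) = a * φ (OuterTensor.mk (β x) _)
    rw [this, map_mk_left_smul]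
  · conv_rhs => rw [← hβ x, hα, hS]
    refine Eq.trans ?_ (map_sum (leftEval φ (β x))
      (fun i : V × U ↦ (OuterTensor.mk i.1 i.2 : OuterTensor k V U)) S).symm
    exact Finset.sum_coe_sort S (fun i : V × U ↦
      (φ (OuterTensor.mk (β x) i.1) ⊗ₜ[k] 1 : Env k A) • i.2)

end Tensor

/-! ### Separable algebras are Calabi-Yau of dimension zero -/

section Unit

variable (k : Type u) (A : Type v) [Field k] [Ring A] [Algebra k A]

/-- Multiplication as a bimodule map. -/
def outerMul : OuterTensor k A A →ₗ[Env k A] A where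
  toFun := LinearMap.mul' k A
  map_add' x y := map_add (LinearMap.mul' k A) x y
  map_smul' r x := by
    rw [RingHom.id_apply]
    change LinearMap.mul' k A (outerAct k A A A r x) = r • LinearMap.mul' k A x
    induction r using TensorProduct.induction_on with
    | zero =>
      rw [env_zero_smul, map_zero]
      exact map_zero (LinearMap.mul' k A)
    | add r s hr hs =>
      rw [map_add, add_smul, ← hr, ← hs]
      exact map_add (LinearMap.mul' k A) _ _
    | tmul a b =>
      induction x using OuterTensor.induction with
      | zero => exact (congrArg _ (map_zero _)).trans ((map_zero _).trans (smul_zero _).symm)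
      | add x y hx hy =>
        refine (congrArg _ (map_add _ _ _)).trans ((map_add _ _ _).trans ?_)
        rw [hx, hy, ← smul_add]
        exact congrArg _ (map_add (LinearMap.mul' k A) x y).symm
      | mk x y =>
        change ((a ⊗ₜ[k] 1 : Env k A) • x) * ((1 ⊗ₜ[k] b : Env k A) • y) =
          (a ⊗ₜ[k] b : Env k A) • (x * y)
        rw [env_tmul_smul, env_tmul_smul, env_tmul_smul]
        simp [mul_assoc]

theorem outerMul_mk (x y : A) : outerMul k A (OuterTensor.mk x y) = x * y := rfl

theorem balancing_le_ker_outerMul : balancing k A A A ≤ LinearMap.ker (outerMul k A) := by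
  refine Submodule.span_le.2 ?_
  rintro _ ⟨x, a, y, rfl⟩
  simp only [SetLike.mem_coe, LinearMap.mem_ker, map_sub, outerMul_mk, env_tmul_smul]
  simp [mul_assoc]

theorem sub_mk_mem_balancing (s : OuterTensor k A A) :
    s - OuterTensor.mk (outerMul k A s) 1 ∈ balancing k A A A := by
  induction s using OuterTensor.induction with
  | zero =>
    rw [map_zero, OuterTensor.mk_zero_left, sub_zero]
    exact Submodule.zero_mem _
  | add s t hs ht =>
    rw [map_add, OuterTensor.mk_add_left, add_sub_add_comm]
    exact Submodule.add_mem _ hs ht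
  | mk x y =>
    rw [← neg_sub]
    refine Submodule.neg_mem _ (Submodule.subset_span ⟨x, y, 1, ?_⟩)
    rw [env_tmul_smul, env_tmul_smul, outerMul_mk]
    simp

/-- The regular bimodule is invertible. -/
theorem isInvertibleBimodule_self : IsInvertibleBimodule k A A := by
  have e : BimodTensor k A A A ≃ₗ[Env k A] A := by
    refine LinearEquiv.ofBijective
      ((balancing k A A A).liftQ (outerMul k A) (balancing_le_ker_outerMul k A)) ⟨?_, ?_⟩
    · rw [← LinearMap.ker_eq_bot, Submodule.ker_liftQ_eq_bot]
      intro s hs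
      have h := sub_mk_mem_balancing k A s
      rw [LinearMap.mem_ker.1 hs] at h
      have h0 : (OuterTensor.mk 0 1 : OuterTensor k A A) = 0 := TensorProduct.zero_tmul _ _
      rwa [h0, sub_zero] at h
    · intro x
      refine ⟨Submodule.Quotient.mk (OuterTensor.mk x 1), ?_⟩
      rw [Submodule.liftQ_apply, outerMul_mk, mul_one]
  exact ⟨A, inferInstance, inferInstance, inferInstance, inferInstance, ⟨e⟩, ⟨e⟩⟩

end Unit

section

variable {k : Type u} {A : Type v} [Field k] [Ring A] [Algebra k A]

instance finite_env_self : Module.Finite (Env k A) A :=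
  Module.Finite.of_surjective (LinearMap.toSpanSingleton (Env k A) A 1)
    fun x ↦ ⟨x ⊗ₜ 1, env_tmul_one_smul_one x⟩

/-- Extensions of degree zero are bimodule maps. -/
def extEnvZeroEquiv : ExtEnv k A 0 ≃+ (A →ₗ[Env k A] Env k A) :=
  Abelian.Ext.addEquiv₀.trans ModuleCat.homAddEquiv

theorem extEnvZeroEquiv_smul (r : Env k A) (x : ExtEnv k A 0) :
    extEnvZeroEquiv (r • x) =
      LinearMap.toSpanSingleton (Env k A) (Env k A) (envSwap k A r) ∘ₗ extEnvZeroEquiv x := by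
  obtain ⟨f, rfl⟩ := (Abelian.Ext.mk₀_bijective _ _).2 x
  have h : r • (show ExtEnv k A 0 from Abelian.Ext.mk₀ f) =
      Abelian.Ext.mk₀ (f ≫ rightMul (Env k A) (envSwap k A r)) := Abelian.Ext.mk₀_comp_mk₀ _ _
  have h' (g : ModuleCat.of (Env k A) A ⟶ ModuleCat.of (Env k A) (Env k A)) :
      extEnvZeroEquiv (Abelian.Ext.mk₀ g : ExtEnv k A 0) = g.hom := by
    have := Abelian.Ext.addEquiv₀.apply_symm_apply g
    exact congrArg ModuleCat.Hom.hom this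
  rw [h]
  exact (h' _).trans (congrArg
    (LinearMap.toSpanSingleton (Env k A) (Env k A) (envSwap k A r) ∘ₗ ·) (h' f).symm)

theorem IsSeparableAlgebra.isCalabiYauOfDim_zero (h : IsSeparableAlgebra k A) :
    IsCalabiYauOfDim k A 0 := by
  have := h.finite
  have hproj := h.projective_env
  obtain ⟨a, ha⟩ := h.exists_twistedTrace_nondegenerate
  refine ⟨IsPerfectModule.of_projective, isInvertibleBimodule_self k A, fun i hi ↦ ?_, ⟨?_⟩⟩
  · obtain ⟨j, rfl⟩ : ∃ j, i = j + 1 := ⟨i - 1, by lia⟩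
    exact Abelian.Ext.subsingleton_of_projective (ModuleCat.of (Env k A) A) _ j
  · refine (extEnvZeroEquiv.trans (homEnvEquiv ha)).toLinearEquiv fun r x ↦ ?_
    rw [AddEquiv.trans_apply, AddEquiv.trans_apply, extEnvZeroEquiv_smul,
      homEnvEquiv_smul (twistedTrace_mul_comm k a)]

theorem IsTwistedCalabiYauOfDim.projective_env (h : IsTwistedCalabiYauOfDim k A 0) :
    Module.Projective (Env k A) A := by
  obtain ⟨U, _, _, _, _, hs, -, hE, -⟩ := h
  obtain ⟨n, hn⟩ := HasFiniteResolution.of_isPerfectModule hs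
  exact projective_of_hasFiniteResolution hn fun i hi ↦ hE i hi.ne'

end

/-! ### Bimodules induced from right modules -/

/-- The bimodule `A ⊗ N` induced from a right `A`-module `N`. -/
def Induced (k : Type u) (A N : Type v) [Field k] [Ring A] [Algebra k A] [AddCommGroup N]
    [Module k N] : Type v :=
  A ⊗[k] N

section Induced

variable {k : Type u} {A : Type v} [Field k] [Ring A] [Algebra k A]
variable {N N' : Type v} [AddCommGroup N] [Module k N]

instance instAddCommGroupInduced : AddCommGroup (Induced k A N) :=
  inferInstanceAs (AddCommGroup (A ⊗[k] N))

/-- The pure tensor `x ⊗ n`. -/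
def Induced.mk (x : A) (n : N) : Induced k A N := x ⊗ₜ[k] n

@[elab_as_elim]
theorem Induced.induction {motive : Induced k A N → Prop} (s : Induced k A N)
    (zero : motive 0) (mk : ∀ x y, motive (Induced.mk x y))
    (add : ∀ s t, motive s → motive t → motive (s + t)) : motive s :=
  TensorProduct.induction_on s zero mk add

theorem Induced.mk_zero_right (x : A) : (Induced.mk x 0 : Induced k A N) = 0 :=
  TensorProduct.tmul_zero _ _

theorem Induced.mk_sum_right {ι : Type*} (s : Finset ι) (x : A) (n : ι → N) :
    (Induced.mk x (∑ i ∈ s, n i) : Induced k A N) = ∑ i ∈ s, Induced.mk x (n i) :=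
  TensorProduct.tmul_sum _ _ _

variable [Module Aᵐᵒᵖ N] [IsScalarTower k Aᵐᵒᵖ N]
variable [AddCommGroup N'] [Module k N'] [Module Aᵐᵒᵖ N'] [IsScalarTower k Aᵐᵒᵖ N']

variable (k A N) in
/-- The algebra map from `A^e` to the endomorphisms of `A ⊗ N`. -/
def inducedAct : Env k A →ₐ[k] Module.End k (A ⊗[k] N) :=
  (Module.endTensorEndAlgHom (R := k) (S := k) (A := k) (M := A) (N := N)).comp
    (Algebra.TensorProduct.map (Algebra.lsmul k k A) (Algebra.lsmul k k N))

instance instModuleInduced : Module (Env k A) (Induced k A N) :=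
  Module.compHom (A ⊗[k] N) (inducedAct k A N).toRingHom

theorem Induced.smul_mk (a : A) (b : Aᵐᵒᵖ) (x : A) (n : N) :
    (a ⊗ₜ[k] b : Env k A) • (Induced.mk x n : Induced k A N) = Induced.mk (a * x) (b • n) := rfl

/-- An additive map out of `A ⊗ N` is linear over `A^e` if it is compatible with the action on pure
tensors. -/
def Induced.toLinearMap {M : Type*} [AddCommGroup M] [Module (Env k A) M]
    (f : Induced k A N →+ M) (hf : ∀ (a : A) (b : Aᵐᵒᵖ) (x : A) (n : N),
      f (Induced.mk (a * x) (b • n)) = (a ⊗ₜ[k] b : Env k A) • f (Induced.mk x n)) :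
    Induced k A N →ₗ[Env k A] M where
  toFun := f
  map_add' := map_add f
  map_smul' r t := by
    rw [RingHom.id_apply]
    induction r using TensorProduct.induction_on with
    | zero =>
      exact (congrArg f (zero_smul (Env k A) t)).trans ((map_zero f).trans
        (zero_smul (Env k A) (f t)).symm)
    | add r s hr hs => rw [add_smul, map_add, hr, hs, add_smul]
    | tmul a b =>
      induction t using Induced.induction with
      | zero => rw [smul_zero, map_zero, smul_zero]
      | add s t hs ht => rw [smul_add, map_add, hs, ht, map_add, smul_add]
      | mk x n => rw [Induced.smul_mk, hf]

/-- The bimodule map induced by a map of right modules. -/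
def Induced.map (f : N →ₗ[Aᵐᵒᵖ] N') : Induced k A N →ₗ[Env k A] Induced k A N' :=
  Induced.toLinearMap ((f.restrictScalars k).lTensor A).toAddMonoidHom fun a b x n ↦ by
    change Induced.mk (a * x) (f (b • n)) = (a ⊗ₜ[k] b : Env k A) • Induced.mk x (f n)
    rw [map_smul, Induced.smul_mk]

theorem Induced.map_mk (f : N →ₗ[Aᵐᵒᵖ] N') (x : A) (n : N) :
    Induced.map f (Induced.mk x n : Induced k A N) = Induced.mk x (f n) := rfl

theorem Induced.map_comp_apply {N'' : Type v} [AddCommGroup N''] [Module k N''] [Module Aᵐᵒᵖ N'']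
    [IsScalarTower k Aᵐᵒᵖ N''] (g : N' →ₗ[Aᵐᵒᵖ] N'') (f : N →ₗ[Aᵐᵒᵖ] N')
    (t : Induced k A N) :
    Induced.map (k := k) (g ∘ₗ f) t = Induced.map g (Induced.map f t) := by
  induction t using Induced.induction with
  | zero => simp only [map_zero]
  | add s t hs ht => simp only [map_add, hs, ht]
  | mk x n => rfl

theorem Induced.shortExact (f : N →ₗ[Aᵐᵒᵖ] N') (hf : Function.Surjective f) :
    (ShortComplex.mk
      (ModuleCat.ofHom (Induced.map (k := k) (LinearMap.ker f).subtype))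
      (ModuleCat.ofHom (Induced.map (k := k) f)) (by
        refine ModuleCat.hom_ext (LinearMap.ext fun t ↦ ?_)
        induction t using Induced.induction with
        | zero => exact map_zero _
        | add s t hs ht => rw [map_add, hs, ht, map_add]
        | mk x n =>
          change Induced.mk x (f n) = 0
          rw [n.2, Induced.mk_zero_right])).ShortExact := by
  refine ModuleCat.shortComplex_shortExact _ ?_ ?_ ?_
  · exact lTensor_exact A (f := (LinearMap.ker f).subtype.restrictScalars k)
      (g := f.restrictScalars k) (LinearMap.exact_subtype_ker_map f) hf
  · exact Module.Flat.lTensor_preserves_injective_linearMap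
      ((LinearMap.ker f).subtype.restrictScalars k) Subtype.val_injective
  · exact LinearMap.lTensor_surjective A (g := f.restrictScalars k) hf

/-- The coordinates of the bimodule induced from a free right module. -/
def Induced.coord {q : ℕ} (j : Fin q) : Induced k A (Fin q → Aᵐᵒᵖ) →ₗ[Env k A] Env k A :=
  Induced.toLinearMap
    ((LinearMap.proj (R := k) (φ := fun _ : Fin q ↦ Aᵐᵒᵖ) j).lTensor A).toAddMonoidHom
    fun a b x n ↦ (Algebra.TensorProduct.tmul_mul_tmul a x b (n j)).symm

theorem Induced.coord_mk {q : ℕ} (j : Fin q) (x : A) (n : Fin q → Aᵐᵒᵖ) :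
    Induced.coord j (Induced.mk x n : Induced k A (Fin q → Aᵐᵒᵖ)) = x ⊗ₜ n j := rfl

theorem Induced.sum_coord {q : ℕ} (t : Induced k A (Fin q → Aᵐᵒᵖ)) :
    ∑ j, Induced.coord j t • (Induced.mk 1 (Pi.single j 1) : Induced k A (Fin q → Aᵐᵒᵖ)) = t := by
  induction t using Induced.induction with
  | zero =>
    refine Finset.sum_eq_zero fun j _ ↦ ?_
    rw [map_zero]
    exact zero_smul (Env k A) (Induced.mk 1 (Pi.single j 1) : Induced k A (Fin q → Aᵐᵒᵖ))
  | add s t hs ht =>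
    conv_rhs => rw [← hs, ← ht, ← Finset.sum_add_distrib]
    refine Finset.sum_congr rfl fun j _ ↦ ?_
    rw [map_add, add_smul]
  | mk x n =>
    conv_rhs => rw [← Finset.univ_sum_single n, Induced.mk_sum_right]
    refine Finset.sum_congr rfl fun j _ ↦ ?_
    rw [Induced.coord_mk, Induced.smul_mk, mul_one, ← Pi.single_smul, smul_eq_mul, mul_one]

theorem Induced.coord_map {q r : ℕ} (f : (Fin q → Aᵐᵒᵖ) →ₗ[Aᵐᵒᵖ] (Fin r → Aᵐᵒᵖ)) (j : Fin r)
    (t : Induced k A (Fin q → Aᵐᵒᵖ)) : Induced.coord j (Induced.map f t) =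
      ∑ i, Induced.coord i t * (1 ⊗ₜ f (Pi.single i 1) j : Env k A) := by
  conv_lhs => rw [← Induced.sum_coord t, map_sum, map_sum]
  refine Finset.sum_congr rfl fun i _ ↦ ?_
  rw [map_smul, map_smul, Induced.map_mk, Induced.coord_mk, smul_eq_mul]

end Induced

/-! ### Finite-dimensional twisted Calabi-Yau algebras -/

section Vanishing

variable {k : Type u} {A : Type v} [Field k] [Ring A] [Algebra k A]

/-- The swap turns the left action of `a` into right multiplication by `1 ⊗ op a`, the form in which
matrices of maps of free right modules act on coordinates. -/
theorem extEnv_left_smul {d : ℕ} (a : A) (x : ExtEnv k A d) :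
    (a ⊗ₜ[k] 1 : Env k A) • x =
      Abelian.Ext.comp x (Abelian.Ext.mk₀ (rightMul (Env k A) (1 ⊗ₜ[k] op a))) (add_zero d) := rfl

variable {N : Type v} [AddCommGroup N] [Module k N] [Module Aᵐᵒᵖ N] [IsScalarTower k Aᵐᵒᵖ N]

/-- The coordinates of an extension class with values in the bimodule induced from a free right
module. -/
def extCoord {d q : ℕ} (η : Abelian.Ext.{v} (ModuleCat.of (Env k A) A)
    (ModuleCat.of (Env k A) (Induced k A (Fin q → Aᵐᵒᵖ))) d) (l : Fin q) : ExtEnv k A d :=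
  η.comp (Abelian.Ext.mk₀ (ModuleCat.ofHom (Induced.coord l))) (add_zero d)

theorem sum_smul_extCoord_eq_zero {d q r : ℕ} (η : Abelian.Ext.{v} (ModuleCat.of (Env k A) A)
    (ModuleCat.of (Env k A) (Induced k A (Fin q → Aᵐᵒᵖ))) d)
    (h : (Fin q → Aᵐᵒᵖ) →ₗ[Aᵐᵒᵖ] (Fin r → Aᵐᵒᵖ))
    (hη : η.comp (Abelian.Ext.mk₀ (ModuleCat.ofHom (Induced.map h))) (add_zero d) = 0)
    (m : Fin r) :
    ∑ l, ((h (Pi.single l 1) m).unop ⊗ₜ[k] 1 : Env k A) • extCoord η l = 0 := by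
  have h1 : ModuleCat.ofHom (Induced.map (k := k) h) ≫ ModuleCat.ofHom (Induced.coord m) =
      ∑ l, ModuleCat.ofHom (Induced.coord l) ≫
        rightMul (Env k A) (1 ⊗ₜ[k] h (Pi.single l 1) m) := by
    refine ModuleCat.hom_ext (LinearMap.ext fun t ↦ ?_)
    rw [ModuleCat.hom_sum, LinearMap.sum_apply]
    exact Induced.coord_map h m t
  have h2 := congrArg (fun ζ ↦ Abelian.Ext.comp ζ
    (Abelian.Ext.mk₀ (ModuleCat.ofHom (Induced.coord m))) (add_zero d)) hη
  simp only [Abelian.Ext.zero_comp, Abelian.Ext.comp_assoc_of_third_deg_zero,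
    Abelian.Ext.mk₀_comp_mk₀] at h2
  rw [h1, Abelian.Ext.mk₀_sum, Abelian.Ext.comp_sum] at h2
  refine Eq.trans (Finset.sum_congr rfl fun l _ ↦ ?_) h2
  rw [extEnv_left_smul, op_unop, ← Abelian.Ext.mk₀_comp_mk₀]
  exact Abelian.Ext.comp_assoc_of_third_deg_zero _ _ _ _

theorem pi_eq_sum_smul_single {q : ℕ} (w : Fin q → Aᵐᵒᵖ) :
    ∑ l, w l • (Pi.single l 1 : Fin q → Aᵐᵒᵖ) = w := by
  conv_rhs => rw [← Finset.univ_sum_single w]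
  refine Finset.sum_congr rfl fun l _ ↦ ?_
  rw [← Pi.single_smul, smul_eq_mul, mul_one]

/-- If `Ext^d(A, A^e)` is finitely generated projective as a left module, then the functor
`N ↦ Ext^d(A, A ⊗ N)` preserves the injectivity of maps to free modules, provided it is right
exact. -/
theorem ext_induced_eq_zero {d : ℕ} {ι : Type v} [Fintype ι] {f : ι → ExtEnv k A d →+ A}
    {s : ι → ExtEnv k A d} (hf : ∀ i a x, f i ((a ⊗ₜ[k] 1 : Env k A) • x) = a * f i x)
    (hs : ∀ x, ∑ i, (f i x ⊗ₜ[k] 1 : Env k A) • s i = x)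
    (hd : ∀ M : ModuleCat.{v} (Env k A),
      Subsingleton (Abelian.Ext.{v} (ModuleCat.of (Env k A) A) M (d + 1)))
    [Module.Finite Aᵐᵒᵖ N] {r : ℕ} (j : N →ₗ[Aᵐᵒᵖ] (Fin r → Aᵐᵒᵖ)) (hj : Function.Injective j)
    (ξ : Abelian.Ext.{v} (ModuleCat.of (Env k A) A) (ModuleCat.of (Env k A) (Induced k A N)) d)
    (hξ : ξ.comp (Abelian.Ext.mk₀ (ModuleCat.ofHom (Induced.map j))) (add_zero d) = 0) : ξ = 0 := by
  obtain ⟨q, π, hπ⟩ := Module.Finite.exists_fin' Aᵐᵒᵖ N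
  -- Right exactness of `Ext^d(A, A ⊗ -)`.
  obtain ⟨η, hη⟩ : ∃ η : Abelian.Ext.{v} (ModuleCat.of (Env k A) A)
      (ModuleCat.of (Env k A) (Induced k A (Fin q → Aᵐᵒᵖ))) d,
      η.comp (Abelian.Ext.mk₀ (ModuleCat.ofHom (Induced.map π))) (add_zero d) = ξ :=
    Abelian.Ext.covariant_sequence_exact₃ _ (Induced.shortExact (k := k) π hπ) ξ rfl
      ((hd _).elim _ _)
  have hcomp : η.comp (Abelian.Ext.mk₀ (ModuleCat.ofHom (Induced.map (j ∘ₗ π))))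
      (add_zero d) = 0 := by
    rw [← hξ, ← hη, Abelian.Ext.comp_assoc_of_third_deg_zero, Abelian.Ext.mk₀_comp_mk₀]
    congr 2
    exact ModuleCat.hom_ext (LinearMap.ext fun t ↦ Induced.map_comp_apply j π t)
  have hc := sum_smul_extCoord_eq_zero η _ hcomp
  -- Applying `f i` to the relations among the coordinates of `η` gives a vector in the free module
  -- killed by `j ∘ π`, hence by `π`. This is flatness of `Ext^d(A, A^e)` made explicit.
  have hw (i : ι) : π (fun l ↦ op (f i (extCoord η l))) = 0 := by
    refine hj ?_
    rw [map_zero]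
    funext m
    have h2 := congrArg (f i) (hc m)
    rw [map_sum, map_zero] at h2
    rw [← pi_eq_sum_smul_single (fun l ↦ op (f i (extCoord η l))), map_sum, map_sum,
      Finset.sum_apply, Pi.zero_apply, ← MulOpposite.op_zero, ← h2, Finset.op_sum]
    refine Finset.sum_congr rfl fun l _ ↦ ?_
    rw [hf, map_smul, map_smul, op_mul, op_unop]
    rfl
  have hx (l : Fin q) : Abelian.Ext.comp η (Abelian.Ext.mk₀ (ModuleCat.ofHom (Induced.coord l)))
      (add_zero d) = ∑ i, Abelian.Ext.comp (s i)
        (Abelian.Ext.mk₀ (rightMul (Env k A) (1 ⊗ₜ op (f i (extCoord η l))))) (add_zero d) := by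
    have h1 := hs (extCoord η l)
    simp only [extEnv_left_smul] at h1
    exact h1.symm
  have key := ext_comp_eq_sum_of_dualBasis (R := Env k A) (M := Induced k A (Fin q → Aᵐᵒᵖ))
    (c := Induced.coord) (e := fun l ↦ Induced.mk 1 (Pi.single l 1)) Induced.sum_coord η s
    (fun i l ↦ 1 ⊗ₜ op (f i (extCoord η l))) hx (Induced.map π)
  rw [← hη, key]
  refine Finset.sum_eq_zero fun i _ ↦ ?_
  have h1 : ∑ l, (1 ⊗ₜ[k] op (f i (extCoord η l)) : Env k A) •
      (Induced.mk 1 (Pi.single l 1) : Induced k A (Fin q → Aᵐᵒᵖ)) =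
      Induced.mk 1 (fun l ↦ op (f i (extCoord η l))) := by
    rw [← pi_eq_sum_smul_single (fun l ↦ op (f i (extCoord η l))), Induced.mk_sum_right]
    refine Finset.sum_congr rfl fun l _ ↦ ?_
    rw [Induced.smul_mk, mul_one]
  have h0 : ModuleCat.ofHom (LinearMap.toSpanSingleton (Env k A) (Induced k A N)
      (Induced.map π (Induced.mk 1 (fun l ↦ op (f i (extCoord η l)))))) = 0 := by
    rw [Induced.map_mk, hw, Induced.mk_zero_right]
    exact ModuleCat.hom_ext (LinearMap.toSpanSingleton_zero (Env k A) (Induced k A N))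
  rw [h1, h0, Abelian.Ext.mk₀_zero]
  exact Abelian.Ext.comp_zero (Y := ModuleCat.of (Env k A) (Env k A)) (s i) _ 0 d (add_zero d)

/-- Vanishing of `Ext^i(A, A ⊗ N)` for `i < d` for a finite-dimensional algebra `A` such that
`Ext^i(A, A^e)` is concentrated in degree `d`, where it is finitely generated projective as a left
module. -/
theorem subsingleton_ext_induced [Module.Finite k A] {d : ℕ} {ι : Type v} [Fintype ι]
    {f : ι → ExtEnv k A d →+ A} {s : ι → ExtEnv k A d}
    (hf : ∀ i a x, f i ((a ⊗ₜ[k] 1 : Env k A) • x) = a * f i x)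
    (hs : ∀ x, ∑ i, (f i x ⊗ₜ[k] 1 : Env k A) • s i = x)
    (hE : ∀ i, i ≠ d → Subsingleton (ExtEnv k A i))
    (hd : ∀ M : ModuleCat.{v} (Env k A),
      Subsingleton (Abelian.Ext.{v} (ModuleCat.of (Env k A) A) M (d + 1)))
    (m i : ℕ) (hi : i + m + 1 = d) (N : Type v) [AddCommGroup N] [Module k N] [Module Aᵐᵒᵖ N]
    [IsScalarTower k Aᵐᵒᵖ N] [Module.Finite k N] : Subsingleton
      (Abelian.Ext.{v} (ModuleCat.of (Env k A) A) (ModuleCat.of (Env k A) (Induced k A N)) i) := by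
  have : Module.Finite k Aᵐᵒᵖ := Module.Finite.equiv (opLinearEquiv k)
  induction m generalizing i N with
  | zero =>
    have : Module.Finite Aᵐᵒᵖ N := Module.Finite.of_restrictScalars_finite k Aᵐᵒᵖ N
    obtain ⟨q, π, hπ⟩ := Module.Finite.exists_fin' Aᵐᵒᵖ N
    refine subsingleton_of_forall_eq 0 fun x ↦ ?_
    have hS := Induced.shortExact (k := k) π hπ
    have : Module.Finite k (LinearMap.ker π) :=
      inferInstanceAs (Module.Finite k ((LinearMap.ker π).restrictScalars k))
    have : Module.Finite Aᵐᵒᵖ (LinearMap.ker π) := Module.Finite.of_restrictScalars_finite k Aᵐᵒᵖ _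
    -- The connecting image dies in the free module by exactness, and `Ext^d` preserves the
    -- injection of the kernel.
    have h0 : x.comp hS.extClass hi = 0 := by
      refine ext_induced_eq_zero hf hs hd (LinearMap.ker π).subtype Subtype.val_injective _ ?_
      exact (Abelian.Ext.comp_assoc_of_third_deg_zero _ _ _ _).trans
        ((congrArg (x.comp · hi) hS.extClass_comp).trans (Abelian.Ext.comp_zero _ _ _ _ _))
    obtain ⟨y, rfl⟩ := Abelian.Ext.covariant_sequence_exact₃ _ hS x hi h0
    have hy := subsingleton_ext_of_dualBasis (hE i (by lia))
      (Induced.sum_coord (k := k) (A := A) (q := q))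
    rw [hy.elim y 0, Abelian.Ext.zero_comp]
  | succ m ih =>
    have : Module.Finite Aᵐᵒᵖ N := Module.Finite.of_restrictScalars_finite k Aᵐᵒᵖ N
    obtain ⟨q, π, hπ⟩ := Module.Finite.exists_fin' Aᵐᵒᵖ N
    refine subsingleton_of_forall_eq 0 fun x ↦ ?_
    have hS := Induced.shortExact (k := k) π hπ
    have : Module.Finite k (LinearMap.ker π) :=
      inferInstanceAs (Module.Finite k ((LinearMap.ker π).restrictScalars k))
    obtain ⟨y, rfl⟩ := Abelian.Ext.covariant_sequence_exact₃ _ hS x rfl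
      ((ih (i + 1) (by lia) (LinearMap.ker π)).elim _ _)
    have hy := subsingleton_ext_of_dualBasis (hE i (by lia))
      (Induced.sum_coord (k := k) (A := A) (q := q))
    rw [hy.elim y 0, Abelian.Ext.zero_comp]

end Vanishing

/-! ### The bimodule of `k`-linear endomorphisms as an induced bimodule -/

section DualModule

variable (k : Type u) (A : Type v) [Field k] [Ring A] [Algebra k A]

/-- A copy of the dual space of a finite-dimensional algebra, in the universe of the algebra. -/
def DualModule (_k : Type u) (A : Type v) : Type v := A

instance instAddCommGroupDualModule : AddCommGroup (DualModule k A) :=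
  inferInstanceAs (AddCommGroup A)

instance instModuleDualModule : Module k (DualModule k A) := inferInstanceAs (Module k A)

instance instFiniteDualModule [h : Module.Finite k A] : Module.Finite k (DualModule k A) := h

variable [Module.Finite k A]

/-- The identification of `DualModule` with the dual space. -/
def DualModule.equiv : DualModule k A ≃ₗ[k] Module.Dual k A :=
  -- Any identification will do, since the right action is transported along it; the copy avoids the
  -- larger universe of `Module.Dual k A`.
  LinearEquiv.ofFinrankEq (R := k) (DualModule k A) (Module.Dual k A)
    (Subspace.dual_finrank_eq (K := k) (V := A)).symm

instance instModuleOpDualModule : Module Aᵐᵒᵖ (DualModule k A) where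
  smul b n := (DualModule.equiv k A).symm (DualModule.equiv k A n ∘ₗ LinearMap.mulLeft k b.unop)
  one_smul n := (DualModule.equiv k A).symm_apply_eq.2 (by ext; simp)
  mul_smul b c n := by
    change (DualModule.equiv k A).symm _ = (DualModule.equiv k A).symm
      (DualModule.equiv k A ((DualModule.equiv k A).symm _) ∘ₗ LinearMap.mulLeft k b.unop)
    rw [LinearEquiv.apply_symm_apply]
    congr 1
    ext; simp
  smul_zero b := (DualModule.equiv k A).symm_apply_eq.2 (by ext; simp)
  smul_add b m n := (DualModule.equiv k A).injective <| by
    change DualModule.equiv k A ((DualModule.equiv k A).symm _) =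
      DualModule.equiv k A ((DualModule.equiv k A).symm (_ : Module.Dual k A) +
        (DualModule.equiv k A).symm (_ : Module.Dual k A))
    rw [map_add, map_add, LinearEquiv.apply_symm_apply, LinearEquiv.apply_symm_apply,
      LinearEquiv.apply_symm_apply, LinearMap.add_comp]
  add_smul b c n := (DualModule.equiv k A).injective <| by
    change DualModule.equiv k A ((DualModule.equiv k A).symm _) =
      DualModule.equiv k A ((DualModule.equiv k A).symm (_ : Module.Dual k A) +
        (DualModule.equiv k A).symm (_ : Module.Dual k A))
    rw [map_add, LinearEquiv.apply_symm_apply, LinearEquiv.apply_symm_apply,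
      LinearEquiv.apply_symm_apply]
    ext; simp [add_mul]
  zero_smul n := (DualModule.equiv k A).symm_apply_eq.2 (by ext; simp)

theorem DualModule.equiv_smul (b : Aᵐᵒᵖ) (n : DualModule k A) (y : A) :
    DualModule.equiv k A (b • n) y = DualModule.equiv k A n (b.unop * y) :=
  LinearMap.congr_fun ((DualModule.equiv k A).apply_symm_apply _) y

instance instIsScalarTowerDualModule : IsScalarTower k Aᵐᵒᵖ (DualModule k A) where
  smul_assoc c b n := (DualModule.equiv k A).injective <| LinearMap.ext fun y ↦ by
    rw [DualModule.equiv_smul, map_smul, LinearMap.smul_apply, DualModule.equiv_smul, unop_smul,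
      smul_mul_assoc, map_smul]

/-- The bimodule induced from the dual of `A` is the bimodule of endomorphisms of `A`. -/
def inducedDualEquiv : A ⊗[k] DualModule k A ≃ₗ[k] (A →ₗ[k] A) :=
  (TensorProduct.congr (.refl k A) (DualModule.equiv k A)).trans
    ((TensorProduct.comm k A (Module.Dual k A)).trans (dualTensorHomEquiv k A A))

theorem inducedDualEquiv_mk (x : A) (n : DualModule k A) (y : A) :
    inducedDualEquiv k A (Induced.mk x n : Induced k A (DualModule k A)) y =
      DualModule.equiv k A n y • x := rfl

theorem inducedDualEquiv_smul (a b : A) (t : Induced k A (DualModule k A)) (y : A) :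
    inducedDualEquiv k A ((a ⊗ₜ[k] op b : Env k A) • t) y =
      a * inducedDualEquiv k A t (b * y) := by
  induction t using Induced.induction with
  | zero =>
    have h : inducedDualEquiv k A (0 : Induced k A (DualModule k A)) = 0 :=
      map_zero (inducedDualEquiv k A)
    rw [smul_zero, h, LinearMap.zero_apply, LinearMap.zero_apply, mul_zero]
  | add s t hs ht =>
    have h (s t : Induced k A (DualModule k A)) : inducedDualEquiv k A (s + t : Induced k A _) =
        inducedDualEquiv k A s + inducedDualEquiv k A t := map_add (inducedDualEquiv k A) s t
    rw [smul_add, h, h, LinearMap.add_apply, LinearMap.add_apply, hs, ht, mul_add]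
  | mk x n =>
    rw [Induced.smul_mk, inducedDualEquiv_mk, inducedDualEquiv_mk, DualModule.equiv_smul, unop_op,
      mul_smul_comm]

/-- Left multiplication, as an additive map from `A` to the endomorphisms of `A`. -/
def mulLeftInducedAddHom : A →+ Induced k A (DualModule k A) :=
  ((inducedDualEquiv k A).symm.toLinearMap ∘ₗ LinearMap.mul k A).toAddMonoidHom

/-- Left multiplication, as a bimodule map from `A` to the endomorphisms of `A`. -/
def mulLeftInduced : A →ₗ[Env k A] Induced k A (DualModule k A) where
  toFun := mulLeftInducedAddHom k A
  map_add' := map_add _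
  map_smul' r x := by
    rw [RingHom.id_apply]
    induction r using TensorProduct.induction_on with
    | zero =>
      rw [env_zero_smul, map_zero]
      exact (zero_smul (Env k A) (mulLeftInducedAddHom k A x)).symm
    | add r s hr hs => rw [add_smul, map_add, hr, hs, add_smul]
    | tmul a b =>
      refine (LinearEquiv.symm_apply_eq _).2 (LinearMap.ext fun y ↦ ?_)
      refine Eq.trans ?_ (inducedDualEquiv_smul k A a b.unop _ y).symm
      refine Eq.trans ?_ (congrArg (a * ·) (LinearMap.congr_fun
        ((inducedDualEquiv k A).apply_symm_apply (LinearMap.mul k A x)) (b.unop * y)).symm)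
      rw [env_tmul_smul]
      simp [mul_assoc]

theorem mulLeftInduced_ne_zero [Nontrivial A] : mulLeftInduced k A ≠ 0 := by
  intro h
  have h1 : (inducedDualEquiv k A).symm (LinearMap.mulLeft k 1) = 0 := LinearMap.congr_fun h 1
  rw [LinearEquiv.map_eq_zero_iff] at h1
  exact one_ne_zero (by simpa using LinearMap.congr_fun h1 1 : (1 : A) = 0)

end DualModule

/-! ### Positive dimension is impossible for nonzero finite-dimensional algebras -/

section

variable {k : Type u} {A : Type v} [Field k] [Ring A] [Algebra k A]

theorem IsTwistedCalabiYau.projective_env [Module.Finite k A] (h : IsTwistedCalabiYau k A) :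
    Module.Projective (Env k A) A := by
  obtain ⟨d, h⟩ := h
  -- The zero algebra is twisted Calabi-Yau of every dimension, so it is set aside.
  rcases subsingleton_or_nontrivial A with hA | hA
  · infer_instance
  rcases Nat.eq_zero_or_pos d with rfl | hd
  · exact h.projective_env
  exfalso
  obtain ⟨U, _, _, _, _, hs, hU, hE, ⟨e⟩⟩ := h
  obtain ⟨n, hn⟩ := HasFiniteResolution.of_isPerfectModule hs
  obtain ⟨ι, _, f, s, hf, hs⟩ := hU.exists_dualBasis
  -- Shifting `d - 1` times reaches degree 0, so there are no nonzero bimodule maps from `A` to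
  -- `End_k(A)`.
  have h0 := subsingleton_ext_induced (k := k) (A := A) (d := d)
    (f := fun i ↦ (f i).comp e.toLinearMap.toAddMonoidHom) (s := fun i ↦ e.symm (s i))
    (fun i a x ↦ by
      change f i (e ((a ⊗ₜ[k] 1 : Env k A) • x)) = a * f i (e x)
      rw [map_smul, hf])
    (fun x ↦ e.injective <| by
      rw [map_sum]
      conv_rhs => rw [← hs (e x)]
      refine Finset.sum_congr rfl fun i _ ↦ ?_
      rw [map_smul, e.apply_symm_apply]
      rfl) hE
    (fun M ↦ subsingleton_ext_of_hasFiniteResolution hn (fun i hi ↦ hE i hi.ne') (d + 1)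
      (Nat.lt_succ_self d) M) (d - 1) 0 (by lia) (DualModule k A)
  refine mulLeftInduced_ne_zero k A ?_
  have h1 := Abelian.Ext.addEquiv₀.symm.injective
    (h0.elim (Abelian.Ext.addEquiv₀.symm (ModuleCat.ofHom (mulLeftInduced k A)))
      (Abelian.Ext.addEquiv₀.symm 0))
  exact ModuleCat.hom_ext_iff.1 h1

theorem IsTwistedCalabiYauOfDim.isTwistedCalabiYau_and_finite
    (h : IsTwistedCalabiYauOfDim k A 0) : IsTwistedCalabiYau k A ∧ Module.Finite k A :=
  ⟨⟨0, h⟩, finite_of_projective_env h.projective_env⟩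

theorem IsCalabiYauOfDim.isTwistedCalabiYauOfDim {d : ℕ} (h : IsCalabiYauOfDim k A d) :
    IsTwistedCalabiYauOfDim k A d :=
  ⟨A, inferInstance, inferInstance, inferInstance, inferInstance, h⟩

end

end TwistedCY

end

theorem mainTheorem4 (k : Type*) [Field k] (A : Type*) [Ring A] [Algebra k A] :
    List.TFAE
      [TwistedCY.IsTwistedCalabiYauOfDim k A 0,
        TwistedCY.IsTwistedCalabiYau k A ∧ Module.Finite k A,
        TwistedCY.IsCalabiYauOfDim k A 0,
        TwistedCY.IsSeparableAlgebra k A] := by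
  tfae_have 1 → 2 := fun h ↦ h.isTwistedCalabiYau_and_finite
  tfae_have 2 → 4 := fun h ↦
    have := h.2
    TwistedCY.isSeparableAlgebra_of_projective_env h.1.projective_env
  tfae_have 4 → 3 := fun h ↦ h.isCalabiYauOfDim_zero
  tfae_have 3 → 1 := fun h ↦ h.isTwistedCalabiYauOfDim
  tfae_finish
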